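/- For $0<q<1$ let $(a;q)_n=\prod_{k=1}^{n}(1-aq^{k-1})$, $(a;q)_\infty=\prod_{k\ge1}(1-aq^{k-1})$, $c_\nu(q)=(q;q)_\infty/(q^{\nu+1};q)_\infty$, and let $$J_\nu^{(2)}(z;q)=\frac{(q^{\nu+1};q)_\infty}{(q;q)_\infty}\sum_{n\ge0}\frac{(-1)^n (z/2)^{2n+\nu}}{(q;q)_n(q^{\nu+1};q)_n}\,q^{n(n+\nu)}$$ be the Jackson $q$-Bessel function. For a function $f$ analytic near $0$ with $f(0)=0$, $f'(0)=1$, the radius of starlikeness $r^*(f)$ is the supremum of all $r>0$ such that $f$ is analytic in $|z|<r$ and $\operatorname{Re}(zf'(z)/f(z))>0$ for $|z|<r$ (the quotient being $1$ at $z=0$). **Theorem.** Let $\nu>0$ and $0<q<1$, and let $f_\nu^{(2)}(z;q)=\left(2^\nu c_\nu(q)J_\nu^{(2)}(z;q)\right)^{1/\nu}$, where the root is the analytic branch with $f(0)=0$, $f'(0)=1$ (which is positive for small $z>0$). Then $f=f_\nu^{(2)}(\cdot;q)$ is analytic in $|z|<r^*(f)$, its radius of starlikeness $r^*(f)$ is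 the smallest positive root of the equation $r\cdot dJ_\nu^{(2)}(r;q)/dr=0$, and $$\frac{4\nu(1-q^{\nu+1})(1-q)}{q^{\nu+1}(\nu+2)}<\left(r^*(f)\right)^2<\frac{4\nu(\nu+2)(1-q^{\nu+1})(1-q^{\nu+2})(1-q^2)}{q^{\nu+1}\left((\nu+2)^2(1+q-q^{\nu+2})-2\nu(\nu+4)q^2+(\nu^2+4\nu-4)q^{\nu+3}\right)}.$$ Moreover, if these inequalities are multiplied by $(1-q)^{-2}$ and $q\nearrow1$, then $r^*(f)/(1-q)$ tends to the first positive zero $j'_{\nu,1}$ of the derivative of the classical Bessel function $J_\nu$, the two bounds tend to $\frac{4\nu(\nu+1)}{\nu+2}$ and $\frac{4\nu(\nu+1)(\nu+2)^2}{\nu^2+8\nu+8}$ respectively, and $$\frac{4\nu(\nu+1)}{\nu+2}<\left(j'_{\nu,1}\right)^2<\frac{4\nu(\nu+1)(\nu+2)^2}{\nu^2+8\nu+8}.$$ -/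

import Mathlib

open Filter Topology

noncomputable section

/-- The finite `q`-shifted factorial `(a; q)_n = ∏_{k=1}^{n} (1 - a q^{k-1})`. -/
def qPoch (a q : ℝ) (n : ℕ) : ℝ := ∏ k ∈ Finset.range n, (1 - a * q ^ k)

/-- The infinite `q`-shifted factorial `(a; q)_∞ = ∏_{k ≥ 1} (1 - a q^{k-1})`. -/
def qPochInf (a q : ℝ) : ℝ := ∏' k : ℕ, (1 - a * q ^ k)

/-- The constant `c_ν(q) = (q; q)_∞ / (q^{ν+1}; q)_∞`. -/
def cConst (ν q : ℝ) : ℝ := qPochInf q q / qPochInf (q ^ (ν + 1)) q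

/-- The Jackson (second) `q`-Bessel function
`J_ν^{(2)}(z; q) = (q^{ν+1}; q)_∞ / (q; q)_∞ *
  ∑_{n ≥ 0} (-1)^n (z/2)^{2n+ν} q^{n(n+ν)} / ((q; q)_n (q^{ν+1}; q)_n)`,
with the principal branch of the power. -/
def jacksonJ (ν q : ℝ) (z : ℂ) : ℂ :=
  ((qPochInf (q ^ (ν + 1)) q / qPochInf q q : ℝ) : ℂ) *
    ∑' n : ℕ, (-1) ^ n * (z / 2) ^ (2 * (n : ℂ) + (ν : ℂ)) /
        ((qPoch q q n * qPoch (q ^ (ν + 1)) q n : ℝ) : ℂ) *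
      ((q ^ ((n : ℝ) * ((n : ℝ) + ν)) : ℝ) : ℂ)

/-- The even entire function `2^ν c_ν(q) z^{-ν} J_ν^{(2)}(z; q)`, which equals `1` at `0`. -/
def jacksonEntire (ν q : ℝ) (z : ℂ) : ℂ :=
  ∑' n : ℕ, (-1) ^ n * (z / 2) ^ (2 * n) /
      ((qPoch q q n * qPoch (q ^ (ν + 1)) q n : ℝ) : ℂ) *
    ((q ^ ((n : ℝ) * ((n : ℝ) + ν)) : ℝ) : ℂ)

/-- The branch of `log g` that vanishes at `0`, for a holomorphic `g` with `g 0 = 1`: the integral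
of `g' / g` along the segment from `0` to `z`. It is the analytic branch at every `z` for which
`g` has no zero on that segment. -/
def segLog (g : ℂ → ℂ) (z : ℂ) : ℂ :=
  ∫ t in (0 : ℝ)..1, z * (deriv g ((t : ℂ) * z) / g ((t : ℂ) * z))

/-- The normalized function `f_ν^{(2)}(z; q) = (2^ν c_ν(q) J_ν^{(2)}(z; q))^{1/ν}`. Here
`2^ν c_ν(q) J_ν^{(2)}(z; q) = z^ν g(z)` with `g = jacksonEntire ν q`, `g 0 = 1`, and the `ν`-th root
is the analytic branch with value `0` and derivative `1` at the origin, that is, `z * g(z)^{1/ν}`. -/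
def fJackson (ν q : ℝ) (z : ℂ) : ℂ :=
  z * Complex.exp (segLog (jacksonEntire ν q) z / (ν : ℂ))

/-- The radius of starlikeness: the supremum of all `r > 0` such that `f` is analytic in
`|z| < r` and `Re (z f'(z) / f(z)) > 0` there. The functions `f` considered satisfy `f 0 = 0` and
`f' 0 = 1`, so at the origin `z f'(z) / f(z)` has the limit `1`, and the condition there is void. -/
def starlikeRadius (f : ℂ → ℂ) : ℝ :=
  sSup {r : ℝ | 0 < r ∧ DifferentiableOn ℂ f (Metric.ball 0 r) ∧
    ∀ z ∈ Metric.ball (0 : ℂ) r, z ≠ 0 → 0 < (z * deriv f z / f z).re}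

/-- The classical Bessel function of the first kind on `x > 0`:
`J_ν(x) = ∑_{n ≥ 0} (-1)^n (x/2)^{2n+ν} / (n! Γ(n+ν+1))`. -/
def besselJ (ν : ℝ) (x : ℝ) : ℝ :=
  ∑' n : ℕ, (-1) ^ n * (x / 2) ^ (2 * (n : ℝ) + ν) /
    ((n.factorial : ℝ) * Real.Gamma ((n : ℝ) + ν + 1))

/-- The lower bound
`4ν (1 - q^{ν+1}) (1 - q) / (q^{ν+1} (ν + 2))`. -/
def lowerBound (ν q : ℝ) : ℝ :=
  4 * ν * (1 - q ^ (ν + 1)) * (1 - q) / (q ^ (ν + 1) * (ν + 2))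

/-- The upper bound, with numerator `4ν (ν+2) (1 - q^{ν+1}) (1 - q^{ν+2}) (1 - q^2)`. -/
def upperBound (ν q : ℝ) : ℝ :=
  4 * ν * (ν + 2) * (1 - q ^ (ν + 1)) * (1 - q ^ (ν + 2)) * (1 - q ^ 2) /
    (q ^ (ν + 1) * ((ν + 2) ^ 2 * (1 + q - q ^ (ν + 2)) - 2 * ν * (ν + 4) * q ^ 2 +
      (ν ^ 2 + 4 * ν - 4) * q ^ (ν + 3)))

end

/-! Write `t = (z / (2(1-q)))²` and `F(t) = ∑ (-1)^n a_n t^n` with `a = qCoeff ν q`, so that `f(z) =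
z F(t)^{1/ν}` and `z f'/f = 1 + ε t F'(t)/F(t)` with `ε = 2/ν`. On the positive axis `r J'(r)` is a
nonvanishing multiple of `F + ε t F'` (`eulerSeries`). Everything is therefore about the least
positive zero `v` of this real function.

If `F` were a polynomial `∏ (1 - x t)` with all `x ≥ 0`, then `-F'/F = ∑ x/(1 - x t)`. Its modulus
at a complex `t` is at most its value at `|t|`, as long as `|t|` stays below the first zero of `F`.
Hence `|ε t F'/F| < 1` for `|t| < v`, while `z f'/f` vanishes at `t = v`: this identifies the
radius. The power sums `s₁ = ∑ x = a_1` and `s₂ = ∑ x² = a_1² - 2 a_2` bound the sum from both sides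
and locate `v`. Cleared of denominators, these inequalities survive coefficientwise limits of such
polynomials, so no product formula for `F` itself is needed; the bound `1/(n!)²` on the coefficients
makes the convergence locally uniform (`closure_rootedCoeffs_inequalities`,
`exists_isLeast_eulerSeries`).

The approximating polynomials are the `q`-Laguerre polynomials. Their three-term recurrence in the
degree is a discrete Stieltjes string, and summation by parts shows that all their zeros are
positive (`string_zero_pos`, `qCoeff_mem_closure`).

As `q ↗ 1` the coefficients tend to those of the classical Bessel series, which therefore lies in
the same closure and obeys the same strict bounds. The sign of `F + ε t F'` changes strictly at its
least zero, which makes that zero continuous in the coefficients (`tendsto_isLeast_eulerSeries`). -/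

/-! ### Alternating power series with factorially bounded coefficients -/

/-- The power series `∑ (-1)^n a_n z^n`. -/
noncomputable def altSeries (a : ℕ → ℝ) (z : ℂ) : ℂ := ∑' n, (-1) ^ n * (a n : ℂ) * z ^ n

/-- The power series `∑ (-1)^n a_n x^n` on the real line. -/
noncomputable def altSeriesReal (a : ℕ → ℝ) (x : ℝ) : ℝ := ∑' n, (-1) ^ n * a n * x ^ n

/-- The coefficients of the derivative of `∑ (-1)^n a_n z^n`. -/
noncomputable def derivCoeff (a : ℕ → ℝ) (n : ℕ) : ℝ := -((n + 1) * a (n + 1))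

/-- Coefficients bounded by those of the exponential series. -/
def ExpBounded (a : ℕ → ℝ) : Prop := ∀ n, |a n| ≤ 1 / (n.factorial : ℝ)

theorem ofReal_altSeriesReal (a : ℕ → ℝ) (x : ℝ) :
    ((altSeriesReal a x : ℝ) : ℂ) = altSeries a x := by
  simp [altSeries, altSeriesReal, Complex.ofReal_tsum]

theorem summable_one_div_factorial_mul_pow (r : ℝ) :
    Summable fun n : ℕ => 1 / (n.factorial : ℝ) * r ^ n := by
  refine (Real.summable_pow_div_factorial r).congr fun n => ?_
  ring

theorem ExpBounded.norm_term_le {a : ℕ → ℝ} (ha : ExpBounded a) (z : ℂ) (n : ℕ) :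
    ‖(-1) ^ n * (a n : ℂ) * z ^ n‖ ≤ 1 / (n.factorial : ℝ) * ‖z‖ ^ n := by
  simp only [norm_mul, norm_pow, norm_neg, norm_one, one_pow, one_mul, Complex.norm_real,
    Real.norm_eq_abs]
  exact mul_le_mul_of_nonneg_right (ha n) (by positivity)

theorem ExpBounded.summable {a : ℕ → ℝ} (ha : ExpBounded a) (z : ℂ) :
    Summable fun n => (-1) ^ n * (a n : ℂ) * z ^ n :=
  Summable.of_norm_bounded (summable_one_div_factorial_mul_pow ‖z‖) (ha.norm_term_le z)

theorem ExpBounded.hasDerivAt {a : ℕ → ℝ} (ha : ExpBounded a) (z : ℂ) :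
    HasDerivAt (altSeries a) (altSeries (derivCoeff a) z) z := by
  have hR : (0 : ℝ) < ‖z‖ + 1 := by positivity
  have key := hasDerivAt_tsum_of_isPreconnected (𝕜 := ℂ) (y₀ := 0) (y := z)
    (g := fun (n : ℕ) (w : ℂ) => (-1) ^ n * (a n : ℂ) * w ^ n)
    (g' := fun (n : ℕ) (w : ℂ) => (-1) ^ n * (a n : ℂ) * (n * w ^ (n - 1)))
    (u := fun n : ℕ => 1 / (n.factorial : ℝ) * (n * (‖z‖ + 1) ^ (n - 1)))
    (t := Metric.ball (0 : ℂ) (‖z‖ + 1)) ?_ Metric.isOpen_ball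
    (convex_ball _ _).isPreconnected ?_ ?_ (by simp [hR]) (ha.summable 0) (by simp)
  · have hs : Summable fun n : ℕ => (-1) ^ n * (a n : ℂ) * (n * z ^ (n - 1)) := by
      rw [← summable_nat_add_iff 1]
      refine Summable.of_norm_bounded (summable_one_div_factorial_mul_pow ‖z‖) fun n => ?_
      simp only [norm_mul, norm_pow, norm_neg, norm_one, one_pow, one_mul, Complex.norm_real,
        Real.norm_eq_abs, add_tsub_cancel_right, Complex.norm_natCast]
      have := ha (n + 1)
      rw [← mul_assoc]
      refine mul_le_mul_of_nonneg_right ?_ (by positivity)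
      calc |a (n + 1)| * ((n + 1 : ℕ) : ℝ)
          ≤ 1 / ((n + 1).factorial : ℝ) * ((n + 1 : ℕ) : ℝ) := by gcongr
        _ = 1 / (n.factorial : ℝ) := by
          rw [Nat.factorial_succ]; push_cast; field_simp
    have he : altSeries (derivCoeff a) z = ∑' n : ℕ, (-1) ^ n * (a n : ℂ) * (n * z ^ (n - 1)) := by
      rw [hs.tsum_eq_zero_add]
      simp only [altSeries, derivCoeff]
      simp only [CharP.cast_eq_zero, zero_mul, mul_zero, zero_add]
      refine tsum_congr fun n => ?_
      push_cast
      ring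
    rw [he]
    exact key
  · rw [← summable_nat_add_iff 1]
    refine (summable_one_div_factorial_mul_pow (‖z‖ + 1)).congr fun n => ?_
    rw [Nat.factorial_succ, add_tsub_cancel_right]; push_cast
    field_simp
  · intro n w _
    exact (hasDerivAt_pow n w).const_mul _
  · intro n w hw
    simp only [norm_mul, norm_pow, norm_neg, norm_one, one_pow, one_mul, Complex.norm_real,
      Real.norm_eq_abs, Complex.norm_natCast]
    have hw' : ‖w‖ ≤ ‖z‖ + 1 := (mem_ball_zero_iff.1 hw).le
    gcongr
    exact ha n

theorem ExpBounded.hasDerivAt_real {a : ℕ → ℝ} (ha : ExpBounded a) (x : ℝ) :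
    HasDerivAt (altSeriesReal a) (altSeriesReal (derivCoeff a) x) x := by
  have h := (ha.hasDerivAt (x : ℂ)).real_of_complex
  have h1 : ∀ b : ℕ → ℝ, ∀ y : ℝ, (altSeries b y).re = altSeriesReal b y := fun b y => by
    rw [← ofReal_altSeriesReal, Complex.ofReal_re]
  simpa only [h1] using h

theorem ExpBounded.continuous_real {a : ℕ → ℝ} (ha : ExpBounded a) :
    Continuous (altSeriesReal a) :=
  continuous_iff_continuousAt.2 fun x => (ha.hasDerivAt_real x).continuousAt

theorem altSeriesReal_zero (a : ℕ → ℝ) : altSeriesReal a 0 = a 0 := by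
  rw [altSeriesReal, tsum_eq_single 0]
  · simp
  · intro n hn; simp [hn]

/-- A majorant of the distance between two series on the disk of radius `r`. -/
noncomputable def coeffDist (a b : ℕ → ℝ) (r : ℝ) : ℝ := ∑' n, |a n - b n| * r ^ n

theorem abs_sub_le_of_expBounded {a b : ℕ → ℝ} (ha : ExpBounded a) (hb : ExpBounded b) (n : ℕ) :
    |a n - b n| ≤ 2 * (1 / (n.factorial : ℝ)) := by
  have := abs_sub (a n) (b n)
  linarith [ha n, hb n]

theorem norm_altSeries_sub_le {a b : ℕ → ℝ} (ha : ExpBounded a) (hb : ExpBounded b) {r : ℝ}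
    {z : ℂ} (hz : ‖z‖ ≤ r) : ‖altSeries a z - altSeries b z‖ ≤ coeffDist a b r := by
  have hr : 0 ≤ r := (norm_nonneg z).trans hz
  rw [altSeries, altSeries, ← (ha.summable z).tsum_sub (hb.summable z)]
  refine tsum_of_norm_bounded (Summable.hasSum ?_) fun n => ?_
  · refine Summable.of_nonneg_of_le (fun n => by positivity) (fun n => ?_)
      ((summable_one_div_factorial_mul_pow r).mul_left 2)
    rw [← mul_assoc]
    exact mul_le_mul_of_nonneg_right (abs_sub_le_of_expBounded ha hb n) (by positivity)
  · rw [← sub_mul, ← mul_sub, ← Complex.ofReal_sub]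
    simp only [norm_mul, norm_pow, norm_neg, norm_one, one_pow, one_mul, Complex.norm_real,
      Real.norm_eq_abs]
    gcongr

theorem abs_altSeriesReal_sub_le {a b : ℕ → ℝ} (ha : ExpBounded a) (hb : ExpBounded b) {r x : ℝ}
    (hx : |x| ≤ r) : |altSeriesReal a x - altSeriesReal b x| ≤ coeffDist a b r := by
  have := norm_altSeries_sub_le ha hb (r := r) (z := (x : ℂ)) (by simpa using hx)
  rwa [← ofReal_altSeriesReal, ← ofReal_altSeriesReal, ← Complex.ofReal_sub, Complex.norm_real]
    at this

/-- Dominated convergence: the common factorial bound upgrades pointwise convergence of coefficients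
to uniform convergence of the series on each disk. -/
theorem tendsto_coeffDist {ι : Type*} {l : Filter ι} {b : ι → ℕ → ℝ} {a : ℕ → ℝ}
    (hb : ∀ᶠ i in l, ExpBounded (b i)) (ha : ExpBounded a) (h : Tendsto b l (𝓝 a)) {r : ℝ}
    (hr : 0 ≤ r) :
    Tendsto (fun i => coeffDist (b i) a r) l (𝓝 0) := by
  have := tendsto_tsum_of_dominated_convergence (𝓕 := l)
    (f := fun i n => |b i n - a n| * r ^ n) (g := fun _ : ℕ => (0 : ℝ))
    (bound := fun n => 2 * (1 / (n.factorial : ℝ) * r ^ n))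
    ((summable_one_div_factorial_mul_pow r).mul_left 2) (fun n => ?_) ?_
  · simpa [coeffDist] using this
  · have h1 := ((tendsto_pi_nhds.1 h n).sub_const (a n)).abs.mul_const (r ^ n)
    simpa using h1
  · filter_upwards [hb] with i hi n
    rw [Real.norm_eq_abs, abs_of_nonneg (by positivity), ← mul_assoc]
    exact mul_le_mul_of_nonneg_right (abs_sub_le_of_expBounded hi ha n) (by positivity)

theorem tendsto_altSeries {ι : Type*} {l : Filter ι} {b : ι → ℕ → ℝ} {a : ℕ → ℝ}
    (hb : ∀ᶠ i in l, ExpBounded (b i)) (ha : ExpBounded a) (h : Tendsto b l (𝓝 a)) (z : ℂ) :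
    Tendsto (fun i => altSeries (b i) z) l (𝓝 (altSeries a z)) := by
  rw [tendsto_iff_norm_sub_tendsto_zero]
  refine squeeze_zero' (Eventually.of_forall fun _ => norm_nonneg _) ?_
    (tendsto_coeffDist hb ha h (norm_nonneg z))
  filter_upwards [hb] with i hi
  exact norm_altSeries_sub_le hi ha le_rfl

theorem tendsto_altSeriesReal {ι : Type*} {l : Filter ι} {b : ι → ℕ → ℝ} {a : ℕ → ℝ}
    (hb : ∀ᶠ i in l, ExpBounded (b i)) (ha : ExpBounded a) (h : Tendsto b l (𝓝 a)) (x : ℝ) :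
    Tendsto (fun i => altSeriesReal (b i) x) l (𝓝 (altSeriesReal a x)) := by
  rw [tendsto_iff_norm_sub_tendsto_zero]
  refine squeeze_zero' (Eventually.of_forall fun _ => norm_nonneg _) ?_
    (tendsto_coeffDist hb ha h (abs_nonneg x))
  filter_upwards [hb] with i hi
  exact abs_altSeriesReal_sub_le hi ha le_rfl

theorem tendsto_derivCoeff {ι : Type*} {l : Filter ι} {b : ι → ℕ → ℝ} {a : ℕ → ℝ}
    (h : Tendsto b l (𝓝 a)) : Tendsto (fun i => derivCoeff (b i)) l (𝓝 (derivCoeff a)) :=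
  tendsto_pi_nhds.2 fun n => ((tendsto_pi_nhds.1 h (n + 1)).const_mul _).neg

/-- Coefficients bounded by `1 / (n!)²`. -/
def BesselBounded (a : ℕ → ℝ) : Prop := ∀ n, |a n| ≤ 1 / (n.factorial : ℝ) ^ 2

theorem BesselBounded.expBounded {a : ℕ → ℝ} (ha : BesselBounded a) : ExpBounded a := fun n => by
  refine (ha n).trans ?_
  have h1 : (1 : ℝ) ≤ n.factorial := by exact_mod_cast n.factorial_pos
  gcongr
  nlinarith

/-- Differentiation costs a factor `n + 1` and shifts the index, and the square on the factorial
pays for it. Hence both `F` and `F'` fall under the exponential bound. -/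
theorem BesselBounded.expBounded_derivCoeff {a : ℕ → ℝ} (ha : BesselBounded a) :
    ExpBounded (derivCoeff a) := fun n => by
  have h1 : (1 : ℝ) ≤ n.factorial := by exact_mod_cast n.factorial_pos
  have h2 := ha (n + 1)
  rw [derivCoeff, abs_neg, abs_mul, abs_of_nonneg (by positivity : (0 : ℝ) ≤ n + 1)]
  calc ((n : ℝ) + 1) * |a (n + 1)| ≤ (n + 1) * (1 / ((n + 1).factorial : ℝ) ^ 2) := by gcongr
    _ = 1 / (((n : ℝ) + 1) * (n.factorial : ℝ) * n.factorial) := by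
      rw [Nat.factorial_succ]; push_cast; field_simp
    _ ≤ 1 / (n.factorial : ℝ) := by
      gcongr
      have : (0 : ℝ) ≤ n := by positivity
      nlinarith [mul_nonneg this (by positivity : (0 : ℝ) ≤ n.factorial)]

/-! ### Polynomials with positive roots and their logarithmic derivatives -/

open Polynomial in
/-- The polynomial `∏ (1 - x X)` over a multiset of numbers `x`. -/
noncomputable def reciprocalRootPoly (s : Multiset ℝ) : ℝ[X] :=
  (s.map fun x => (1 - C x * X : ℝ[X])).prod

/-- The sum `∑ x / (1 - x z)`, the logarithmic derivative of `∏ (1 - x z)` up to sign. -/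
noncomputable def reciprocalRootSum (s : Multiset ℝ) (z : ℂ) : ℂ :=
  (s.map fun x : ℝ => (x : ℂ) / (1 - x * z)).sum

/-- The sum `∑ x / (1 - x r)` at a real point. -/
noncomputable def reciprocalRootSumReal (s : Multiset ℝ) (r : ℝ) : ℝ :=
  (s.map fun x : ℝ => x / (1 - x * r)).sum

open Polynomial in
theorem altSeries_eq_aeval {a : ℕ → ℝ} {P : ℝ[X]} (h : ∀ n, P.coeff n = (-1) ^ n * a n) (z : ℂ) :
    altSeries a z = aeval z P := by
  rw [aeval_eq_sum_range, altSeries, tsum_eq_sum (s := Finset.range (P.natDegree + 1))]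
  · refine Finset.sum_congr rfl fun n _ => ?_
    rw [h n, Complex.real_smul]
    push_cast
    ring
  · intro n hn
    have h1 : P.coeff n = 0 := coeff_eq_zero_of_natDegree_lt (by simpa using hn)
    have h2 : (-1 : ℝ) ^ n * a n = 0 := by rw [← h n, h1]
    have h3 : a n = 0 := by simpa using h2
    simp [h3]

open Polynomial in
theorem coeff_derivative_eq {a : ℕ → ℝ} {P : ℝ[X]} (h : ∀ n, P.coeff n = (-1) ^ n * a n) (n : ℕ) :
    (derivative P).coeff n = (-1) ^ n * derivCoeff a n := by
  rw [coeff_derivative, h, derivCoeff]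
  ring

section
variable {s : Multiset ℝ}

theorem reciprocalRootPoly_cons (x : ℝ) (s : Multiset ℝ) :
    reciprocalRootPoly (x ::ₘ s) =
      (1 - Polynomial.C x * Polynomial.X) * reciprocalRootPoly s := by
  simp [reciprocalRootPoly]

theorem reciprocalRootSum_cons (x : ℝ) (s : Multiset ℝ) (z : ℂ) :
    reciprocalRootSum (x ::ₘ s) z = x / (1 - x * z) + reciprocalRootSum s z := by
  simp [reciprocalRootSum]

theorem reciprocalRootSumReal_cons (x : ℝ) (s : Multiset ℝ) (r : ℝ) :
    reciprocalRootSumReal (x ::ₘ s) r = x / (1 - x * r) + reciprocalRootSumReal s r := by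
  simp [reciprocalRootSumReal]

theorem ofReal_reciprocalRootSumReal (r : ℝ) :
    ((reciprocalRootSumReal s r : ℝ) : ℂ) = reciprocalRootSum s r := by
  induction s using Multiset.induction_on with
  | empty => simp [reciprocalRootSumReal, reciprocalRootSum]
  | cons x s ih =>
    rw [reciprocalRootSum_cons, reciprocalRootSumReal_cons, ← ih]
    push_cast
    rfl

theorem one_sub_mul_le_norm {x r : ℝ} {z : ℂ} (hx : 0 ≤ x) (hz : ‖z‖ ≤ r) :
    1 - x * r ≤ ‖1 - (x : ℂ) * z‖ := by
  have h1 := norm_sub_norm_le (1 : ℂ) (x * z)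
  have h2 : ‖(x : ℂ) * z‖ ≤ x * r := by
    rw [norm_mul, Complex.norm_real, Real.norm_of_nonneg hx]
    gcongr
  rw [norm_one] at h1
  linarith

open Polynomial in
theorem aeval_derivative_reciprocalRootPoly {z : ℂ} (h : ∀ x ∈ s, (1 - (x : ℂ) * z) ≠ 0) :
    aeval z (derivative (reciprocalRootPoly s)) =
      -(aeval z (reciprocalRootPoly s) * reciprocalRootSum s z) := by
  induction s using Multiset.induction_on with
  | empty => simp [reciprocalRootPoly, reciprocalRootSum]
  | cons x s ih =>
    have h1 := h x (by simp)
    rw [reciprocalRootPoly_cons, reciprocalRootSum_cons, derivative_mul, map_add, map_mul, map_mul,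
      ih fun y hy => h y (by simp [hy])]
    simp only [derivative_one, derivative_mul, derivative_C, derivative_X, zero_mul,
      mul_one, zero_add, zero_sub, map_neg, map_sub, map_one, map_mul, aeval_C, aeval_X,
      Complex.coe_algebraMap]
    field_simp
    ring

open Polynomial in
theorem eval_reciprocalRootPoly_le_norm {r : ℝ} {z : ℂ} (hz : ‖z‖ ≤ r)
    (h : ∀ x ∈ s, 0 ≤ x ∧ x * r < 1) :
    0 < eval r (reciprocalRootPoly s) ∧
      eval r (reciprocalRootPoly s) ≤ ‖aeval z (reciprocalRootPoly s)‖ := by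
  induction s using Multiset.induction_on with
  | empty => simp [reciprocalRootPoly]
  | cons x s ih =>
    obtain ⟨h0, h1⟩ := h x (by simp)
    obtain ⟨i0, i1⟩ := ih fun y hy => h y (by simp [hy])
    rw [reciprocalRootPoly_cons]
    simp only [eval_mul, eval_sub, eval_one, eval_C, eval_X, map_mul, map_sub, map_one, aeval_C,
      aeval_X, Complex.coe_algebraMap, norm_mul]
    have h2 : 0 < 1 - x * r := by linarith
    exact ⟨by positivity, mul_le_mul (one_sub_mul_le_norm h0 hz) i1 i0.le (norm_nonneg _)⟩

theorem norm_reciprocalRootSum_le {r : ℝ} {z : ℂ} (hz : ‖z‖ ≤ r)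
    (h : ∀ x ∈ s, 0 ≤ x ∧ x * r < 1) :
    ‖reciprocalRootSum s z‖ ≤ reciprocalRootSumReal s r := by
  induction s using Multiset.induction_on with
  | empty => simp [reciprocalRootSum, reciprocalRootSumReal]
  | cons x s ih =>
    obtain ⟨h0, h1⟩ := h x (by simp)
    have i1 := ih fun y hy => h y (by simp [hy])
    rw [reciprocalRootSum_cons, reciprocalRootSumReal_cons]
    refine (norm_add_le _ _).trans (add_le_add ?_ i1)
    rw [norm_div, Complex.norm_real, Real.norm_of_nonneg h0]
    have h2 : 0 < 1 - x * r := by linarith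
    exact div_le_div_of_nonneg_left h0 h2 (one_sub_mul_le_norm h0 hz)

theorem reciprocalRootSumReal_mono {r r' : ℝ} (hr : r ≤ r') (h : ∀ x ∈ s, 0 ≤ x ∧ x * r' < 1) :
    reciprocalRootSumReal s r ≤ reciprocalRootSumReal s r' := by
  refine Multiset.sum_map_le_sum_map _ _ fun x hx => ?_
  obtain ⟨h0, h1⟩ := h x hx
  have h2 : x * r ≤ x * r' := by gcongr
  exact div_le_div_of_nonneg_left h0 (by linarith) (by linarith)

/-- Convexity of `1/y`: the tangent inequality `1/y ≥ 2c - c² y` at `y = 1 - x r`, summed with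
weights `x`. Optimizing `c` would give Cauchy–Schwarz, `s₁² / (s₁ - s₂ r)`; leaving `c` free avoids
the division. -/
theorem tangent_le_reciprocalRootSumReal {r : ℝ} (c : ℝ) (h : ∀ x ∈ s, 0 ≤ x ∧ x * r < 1) :
    2 * c * s.sum - c ^ 2 * (s.sum - (s.map (· ^ 2)).sum * r) ≤ reciprocalRootSumReal s r := by
  induction s using Multiset.induction_on with
  | empty => simp [reciprocalRootSumReal]
  | cons x s ih =>
    obtain ⟨h0, h1⟩ := h x (by simp)
    have i1 := ih fun y hy => h y (by simp [hy])
    rw [reciprocalRootSumReal_cons]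
    simp only [Multiset.sum_cons, Multiset.map_cons]
    have h2 : 0 < 1 - x * r := by linarith
    have h3 : 2 * c * x - c ^ 2 * (x - x ^ 2 * r) ≤ x / (1 - x * r) := by
      rw [le_div_iff₀ h2]
      nlinarith [mul_nonneg h0 (sq_nonneg (1 - c * (1 - x * r)))]
    linarith

/-- Termwise, `x/(1 - x r) = x + x² r/(1 - x r) ≤ x + x² r/(1 - A r)`. -/
theorem reciprocalRootSumReal_mul_le {r A : ℝ} (hr : 0 ≤ r) (hA : A * r < 1)
    (h : ∀ x ∈ s, 0 ≤ x ∧ x ≤ A) :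
    reciprocalRootSumReal s r * (1 - A * r) ≤
      s.sum * (1 - A * r) + (s.map (· ^ 2)).sum * r := by
  induction s using Multiset.induction_on with
  | empty => simp [reciprocalRootSumReal]
  | cons x s ih =>
    obtain ⟨h0, h1⟩ := h x (by simp)
    have i1 := ih fun y hy => h y (by simp [hy])
    rw [reciprocalRootSumReal_cons]
    simp only [Multiset.sum_cons, Multiset.map_cons]
    have h4 : x * r ≤ A * r := by gcongr
    have h2 : 0 < 1 - x * r := by linarith
    have h3 : x / (1 - x * r) * (1 - A * r) ≤ x * (1 - A * r) + x ^ 2 * r := by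
      rw [div_mul_eq_mul_div, div_le_iff₀ h2]
      nlinarith [mul_nonneg (mul_nonneg (mul_nonneg h0 h0) hr) (sub_nonneg.2 h4)]
    linarith

theorem coeff_reciprocalRootPoly (s : Multiset ℝ) :
    (reciprocalRootPoly s).coeff 0 = 1 ∧ (reciprocalRootPoly s).coeff 1 = -s.sum ∧
      2 * (reciprocalRootPoly s).coeff 2 = s.sum ^ 2 - (s.map (· ^ 2)).sum := by
  induction s using Multiset.induction_on with
  | empty => simp [reciprocalRootPoly, Polynomial.coeff_one]
  | cons x s ih =>
    obtain ⟨h0, h1, h2⟩ := ih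
    rw [reciprocalRootPoly_cons]
    have e0 : ∀ n, ((1 - Polynomial.C x * Polynomial.X) * reciprocalRootPoly s).coeff (n + 1) =
        (reciprocalRootPoly s).coeff (n + 1) - x * (reciprocalRootPoly s).coeff n := fun n => by
      rw [sub_mul, one_mul, mul_assoc, Polynomial.coeff_sub, Polynomial.coeff_C_mul,
        Polynomial.coeff_X_mul]
    refine ⟨?_, ?_, ?_⟩
    · rw [Polynomial.mul_coeff_zero, h0]; simp
    · rw [e0, h0, h1, Multiset.sum_cons]; ring
    · rw [e0, h1, mul_sub, h2]; simp only [Multiset.sum_cons, Multiset.map_cons]; ring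

end

/-! ### Coefficientwise limits of polynomials with positive roots -/

/-- The coefficient sequences of the polynomials with positive roots and constant term `1`
(with signs removed), bounded by `1 / (n!)²`. -/
def rootedCoeffs : Set (ℕ → ℝ) :=
  {a | BesselBounded a ∧ ∃ s : Multiset ℝ, (∀ x ∈ s, 0 ≤ x) ∧
    ∀ n, (reciprocalRootPoly s).coeff n = (-1) ^ n * a n}

theorem isClosed_besselBounded : IsClosed {a : ℕ → ℝ | BesselBounded a} := by
  simp only [BesselBounded, Set.ofPred_forall]
  exact isClosed_iInter fun n => isClosed_le (continuous_apply n).abs continuous_const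

theorem besselBounded_of_mem_closure {a : ℕ → ℝ} (ha : a ∈ closure rootedCoeffs) :
    BesselBounded a :=
  closure_minimal (fun _ h => h.1) isClosed_besselBounded ha

/-- Inequalities for `∏ (1 - x z)`, with `x ≥ 0`, on the disk of a radius `r` up to which the
product is positive on the half-axis. -/
theorem rootedCoeffs_inequalities {a : ℕ → ℝ} (ha : a ∈ rootedCoeffs) {r : ℝ} (hr : 0 ≤ r)
    (hpos : ∀ t ∈ Set.Icc 0 r, 0 < altSeriesReal a t) :
    (∀ z : ℂ, ‖z‖ ≤ r → altSeriesReal a r ≤ ‖altSeries a z‖) ∧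
    (∀ z : ℂ, ‖z‖ ≤ r → ‖altSeries (derivCoeff a) z‖ * altSeriesReal a r ≤
      ‖altSeries a z‖ * -altSeriesReal (derivCoeff a) r) ∧
    (∀ c : ℝ, altSeriesReal a r * (2 * c * a 1 - c ^ 2 * (a 1 - (a 1 ^ 2 - 2 * a 2) * r)) ≤
      -altSeriesReal (derivCoeff a) r) ∧
    (∀ t ∈ Set.Icc 0 r, -altSeriesReal (derivCoeff a) t * altSeriesReal a r ≤
      altSeriesReal a t * -altSeriesReal (derivCoeff a) r) ∧
    (a 1 * r < 1 → -altSeriesReal (derivCoeff a) r * (1 - a 1 * r) ≤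
      altSeriesReal a r * (a 1 * (1 - a 1 * r) + (a 1 ^ 2 - 2 * a 2) * r)) := by
  obtain ⟨_, s, hs, hc⟩ := ha
  have eC : ∀ z, altSeries a z = Polynomial.aeval z (reciprocalRootPoly s) := altSeries_eq_aeval hc
  have eC' : ∀ z, altSeries (derivCoeff a) z =
      Polynomial.aeval z (Polynomial.derivative (reciprocalRootPoly s)) :=
    altSeries_eq_aeval (coeff_derivative_eq hc)
  have eR : ∀ t, altSeriesReal a t = Polynomial.eval t (reciprocalRootPoly s) := fun t => by
    have := eC t
    rw [← ofReal_altSeriesReal] at this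
    have h2 := Polynomial.aeval_algebraMap_apply_eq_algebraMap_eval (A := ℂ) t
      (reciprocalRootPoly s)
    rw [Complex.coe_algebraMap] at h2
    rw [h2] at this
    exact_mod_cast this
  -- A factor with `x t ≥ 1` would put the zero `x⁻¹` inside `[0, r]`, against positivity there.
  have hx : ∀ t ∈ Set.Icc 0 r, ∀ x ∈ s, 0 ≤ x ∧ x * t < 1 := by
    intro t ht x hxs
    refine ⟨hs x hxs, ?_⟩
    by_contra! hcon
    have hx0 : 0 < x := by
      rcases (hs x hxs).eq_or_lt with h | h
      · rw [← h] at hcon; linarith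
      · exact h
    have h1 : x⁻¹ ≤ t := by rw [inv_le_iff_one_le_mul₀ hx0]; linarith
    have h2 := hpos x⁻¹ ⟨by positivity, h1.trans ht.2⟩
    obtain ⟨s', rfl⟩ := Multiset.exists_cons_of_mem hxs
    rw [eR, reciprocalRootPoly_cons] at h2
    simp [hx0.ne'] at h2
  have hxr := hx r ⟨hr, le_rfl⟩
  have hD : ∀ t ∈ Set.Icc 0 r, ∀ z : ℂ, ‖z‖ ≤ t →
      altSeries (derivCoeff a) z = -(altSeries a z * reciprocalRootSum s z) := by
    intro t ht z hz
    rw [eC, eC']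
    refine aeval_derivative_reciprocalRootPoly fun x hxs h0 => ?_
    have := one_sub_mul_le_norm (hs x hxs) hz
    rw [h0, norm_zero] at this
    linarith [(hx t ht x hxs).2]
  have hDr : ∀ t ∈ Set.Icc 0 r, -altSeriesReal (derivCoeff a) t =
      altSeriesReal a t * reciprocalRootSumReal s t := by
    intro t ht
    have h1 := hD t ht (t : ℂ) (by simp [abs_of_nonneg ht.1])
    rw [← ofReal_altSeriesReal, ← ofReal_altSeriesReal, ← ofReal_reciprocalRootSumReal] at h1
    rw [neg_eq_iff_eq_neg]
    exact_mod_cast h1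
  have hDrr := hDr r ⟨hr, le_rfl⟩
  have hFr := hpos r ⟨hr, le_rfl⟩
  obtain ⟨-, c1, c2⟩ := coeff_reciprocalRootPoly s
  rw [hc] at c1 c2
  have a1 : a 1 = s.sum := by linarith
  have a2 : a 1 ^ 2 - 2 * a 2 = (s.map (· ^ 2)).sum := by rw [a1]; linarith
  refine ⟨fun z hz => ?_, fun z hz => ?_, fun c => ?_, fun t ht => ?_, fun h1 => ?_⟩
  · rw [eR, eC]
    exact (eval_reciprocalRootPoly_le_norm hz hxr).2
  · rw [hDrr, hD r ⟨hr, le_rfl⟩ z hz, norm_neg, norm_mul]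
    have := mul_le_mul_of_nonneg_left (norm_reciprocalRootSum_le hz hxr)
      (mul_nonneg (norm_nonneg (altSeries a z)) hFr.le)
    linarith
  · rw [hDrr, a2, a1]
    exact mul_le_mul_of_nonneg_left (tangent_le_reciprocalRootSumReal c hxr) hFr.le
  · rw [hDr t ht, hDrr]
    have := mul_le_mul_of_nonneg_left (reciprocalRootSumReal_mono ht.2 hxr)
      (mul_nonneg (hpos t ht).le hFr.le)
    linarith
  · rw [hDrr, a2, a1, mul_assoc]
    -- The bound `A` for the individual `x` is their sum `a 1`, the only one visible in the
    -- coefficients.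
    refine mul_le_mul_of_nonneg_left (reciprocalRootSumReal_mul_le hr (a1 ▸ h1) fun x hxs => ?_)
      hFr.le
    exact ⟨hs x hxs, Multiset.single_le_sum hs x hxs⟩

/-- The inequalities of `rootedCoeffs_inequalities` persist in limits. -/
theorem closure_rootedCoeffs_inequalities {a : ℕ → ℝ} (ha : a ∈ closure rootedCoeffs) {r : ℝ}
    (hr : 0 ≤ r) (hpos : ∀ t ∈ Set.Icc 0 r, 0 < altSeriesReal a t) :
    (∀ z : ℂ, ‖z‖ ≤ r → altSeriesReal a r ≤ ‖altSeries a z‖) ∧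
    (∀ z : ℂ, ‖z‖ ≤ r → ‖altSeries (derivCoeff a) z‖ * altSeriesReal a r ≤
      ‖altSeries a z‖ * -altSeriesReal (derivCoeff a) r) ∧
    (∀ c : ℝ, altSeriesReal a r * (2 * c * a 1 - c ^ 2 * (a 1 - (a 1 ^ 2 - 2 * a 2) * r)) ≤
      -altSeriesReal (derivCoeff a) r) ∧
    (∀ t ∈ Set.Icc 0 r, -altSeriesReal (derivCoeff a) t * altSeriesReal a r ≤
      altSeriesReal a t * -altSeriesReal (derivCoeff a) r) ∧
    (a 1 * r < 1 → -altSeriesReal (derivCoeff a) r * (1 - a 1 * r) ≤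
      altSeriesReal a r * (a 1 * (1 - a 1 * r) + (a 1 ^ 2 - 2 * a 2) * r)) := by
  have hab := besselBounded_of_mem_closure ha
  obtain ⟨b, hb, hlim⟩ := mem_closure_iff_seq_limit.1 ha
  have hbe : ∀ᶠ n in atTop, ExpBounded (b n) := Eventually.of_forall fun n => (hb n).1.expBounded
  have hbe' : ∀ᶠ n in atTop, ExpBounded (derivCoeff (b n)) :=
    Eventually.of_forall fun n => (hb n).1.expBounded_derivCoeff
  have l1 := tendsto_altSeries hbe hab.expBounded hlim
  have l2 := tendsto_altSeriesReal hbe hab.expBounded hlim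
  have l3 := tendsto_altSeries hbe' hab.expBounded_derivCoeff (tendsto_derivCoeff hlim)
  have l4 := tendsto_altSeriesReal hbe' hab.expBounded_derivCoeff (tendsto_derivCoeff hlim)
  have c1 := tendsto_pi_nhds.1 hlim 1
  have c2 := tendsto_pi_nhds.1 hlim 2
  have c3 := (c1.pow 2).sub (c2.const_mul 2)
  -- Uniform convergence beats the positive minimum of the limit on `[0, r]`, so the approximants
  -- satisfy the same positivity hypothesis.
  have hev : ∀ᶠ n in atTop, ∀ t ∈ Set.Icc 0 r, 0 < altSeriesReal (b n) t := by
    obtain ⟨m, hm, hmin⟩ := isCompact_Icc.exists_isMinOn (Set.nonempty_Icc.2 hr)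
      (hab.expBounded.continuous_real.continuousOn (s := Set.Icc 0 r))
    have hd := tendsto_coeffDist hbe hab.expBounded hlim hr
    filter_upwards [hd.eventually_lt_const (hpos m hm)] with n hn t ht
    have h1 := abs_altSeriesReal_sub_le (hb n).1.expBounded hab.expBounded
      (r := r) (x := t) (by rw [abs_of_nonneg ht.1]; exact ht.2)
    have h2 : altSeriesReal a m ≤ altSeriesReal a t := hmin ht
    have h3 := abs_le.1 h1
    linarith [h3.1]
  have key := hev.mono fun n hn => rootedCoeffs_inequalities (hb n) hr hn
  refine ⟨fun z hz => ?_, fun z hz => ?_, fun c => ?_, fun t ht => ?_, fun h1 => ?_⟩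
  · exact le_of_tendsto_of_tendsto (l2 r) (l1 z).norm (key.mono fun n h => h.1 z hz)
  · exact le_of_tendsto_of_tendsto ((l3 z).norm.mul (l2 r)) ((l1 z).norm.mul (l4 r).neg)
      (key.mono fun n h => h.2.1 z hz)
  · exact le_of_tendsto_of_tendsto ((l2 r).mul ((c1.const_mul (2 * c)).sub
      ((c1.sub (c3.mul_const r)).const_mul (c ^ 2)))) (l4 r).neg (key.mono fun n h => h.2.2.1 c)
  · exact le_of_tendsto_of_tendsto ((l4 t).neg.mul (l2 r)) ((l2 t).mul (l4 r).neg)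
      (key.mono fun n h => h.2.2.2.1 t ht)
  · have c4 := (c1.mul_const r).const_sub 1
    refine le_of_tendsto_of_tendsto ((l4 r).neg.mul c4) ((l2 r).mul ((c1.mul c4).add
      (c3.mul_const r))) ?_
    filter_upwards [key, (c1.mul_const r).eventually_lt_const h1] with n h h'
    exact h.2.2.2.2 h'

/-! ### The least positive zero of `F + ε t F'` -/

/-- The function `F(t) + ε t F'(t)` for `F(t) = ∑ (-1)^n a_n t^n`. -/
noncomputable def eulerSeries (a : ℕ → ℝ) (ε t : ℝ) : ℝ :=
  altSeriesReal a t + ε * t * altSeriesReal (derivCoeff a) t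

theorem BesselBounded.continuous_eulerSeries {a : ℕ → ℝ} (ha : BesselBounded a) (ε : ℝ) :
    Continuous (eulerSeries a ε) :=
  ha.expBounded.continuous_real.add
    ((continuous_const.mul continuous_id).mul ha.expBounded_derivCoeff.continuous_real)

theorem eulerSeries_zero {a : ℕ → ℝ} (h0 : a 0 = 1) (ε : ℝ) : eulerSeries a ε 0 = 1 := by
  simp [eulerSeries, altSeriesReal_zero, h0]

theorem eulerSeries_exists_root {a : ℕ → ℝ} (ha : BesselBounded a) (h0 : a 0 = 1) {ε t : ℝ}
    (ht : 0 ≤ t) (h : eulerSeries a ε t ≤ 0) : ∃ v, 0 < v ∧ v ≤ t ∧ eulerSeries a ε v = 0 := by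
  have h1 := eulerSeries_zero h0 ε
  obtain ⟨v, hv, hv0⟩ := intermediate_value_Icc' ht (ha.continuous_eulerSeries ε).continuousOn
    (show (0 : ℝ) ∈ Set.Icc (eulerSeries a ε t) (eulerSeries a ε 0) from ⟨h, by rw [h1]; simp⟩)
  refine ⟨v, lt_of_le_of_ne hv.1 ?_, hv.2, hv0⟩
  rintro rfl
  rw [h1] at hv0
  exact one_ne_zero hv0

/-- The derivative of `t^{1/ε} F(t)` is `(1/ε) t^{1/ε - 1} (F + ε t F')`. So `t^{1/ε} F` is
nondecreasing on `[0, V]`, and it is positive just to the right of `0`. Thus `F` has no zero before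
`F + ε t F'` becomes negative. -/
theorem altSeriesReal_pos_of_eulerSeries_pos {a : ℕ → ℝ} (ha : BesselBounded a) (h0 : a 0 = 1)
    {ε V : ℝ} (hε : 0 < ε) (hH : ∀ t ∈ Set.Ioo 0 V, 0 ≤ eulerSeries a ε t) :
    ∀ t ∈ Set.Icc 0 V, 0 < altSeriesReal a t := by
  have hF0 : altSeriesReal a 0 = 1 := by rw [altSeriesReal_zero, h0]
  have hp : 0 < 1 / ε := by positivity
  have hmono : MonotoneOn (fun t : ℝ => t ^ (1 / ε) * altSeriesReal a t) (Set.Icc 0 V) := by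
    have hder : ∀ t ∈ Set.Ioo 0 V, HasDerivAt (fun t : ℝ => t ^ (1 / ε) * altSeriesReal a t)
        (1 / ε * t ^ (1 / ε - 1) * eulerSeries a ε t) t := by
      intro t ht
      have h1 := (Real.hasDerivAt_rpow_const (x := t) (p := 1 / ε) (Or.inl ht.1.ne')).mul
        (ha.expBounded.hasDerivAt_real t)
      refine h1.congr_deriv ?_
      have h2 : t ^ (1 / ε) = t ^ (1 / ε - 1) * t := by
        rw [Real.rpow_sub_one ht.1.ne', div_mul_cancel₀ _ ht.1.ne']
      rw [h2, eulerSeries]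
      field_simp
    refine monotoneOn_of_deriv_nonneg (convex_Icc 0 V) ?_ ?_ ?_
    · exact ((Real.continuous_rpow_const hp.le).mul ha.expBounded.continuous_real).continuousOn
    · rw [interior_Icc]
      exact fun t ht => (hder t ht).differentiableAt.differentiableWithinAt
    · rw [interior_Icc]
      intro t ht
      rw [(hder t ht).deriv]
      have := ht.1
      have := hH t ht
      positivity
  intro t ht
  rcases ht.1.eq_or_lt with rfl | ht0
  · rw [hF0]; exact one_pos
  have hev : ∀ᶠ s in 𝓝[>] (0 : ℝ), 0 < altSeriesReal a s :=
    (ha.expBounded.continuous_real.continuousAt.tendsto.mono_left nhdsWithin_le_nhds).eventually_const_lt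
      (by rw [hF0]; exact one_pos)
  obtain ⟨s, hs, hst⟩ := (hev.and (Ioo_mem_nhdsGT ht0)).exists
  have h1 := hmono ⟨hst.1.le, hst.2.le.trans ht.2⟩ ht hst.2.le
  have h2 : 0 < s ^ (1 / ε) * altSeriesReal a s := mul_pos (Real.rpow_pos_of_pos hst.1 _) hs
  exact pos_of_mul_pos_right (h2.trans_le h1) (Real.rpow_nonneg ht.1 _)

/-- The least positive zero of `F + ε t F'`, with the Euler–Rayleigh bounds. -/
theorem exists_isLeast_eulerSeries {a : ℕ → ℝ} (ha : a ∈ closure rootedCoeffs) (h0 : a 0 = 1)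
    (h1 : 0 < a 1) (h2 : 0 < a 2) (h12 : 2 * a 2 < a 1 ^ 2) {ε : ℝ} (hε : 0 < ε) :
    ∃ v, IsLeast {t | 0 < t ∧ eulerSeries a ε t = 0} v ∧
      (∀ t ∈ Set.Icc 0 v, 0 < altSeriesReal a t) ∧
      (∀ t ∈ Set.Ico 0 v, 0 < eulerSeries a ε t) ∧
      (∃ w > v, (∀ t ∈ Set.Ico 0 w, 0 < altSeriesReal a t) ∧
        ∀ t ∈ Set.Ioo v w, eulerSeries a ε t < 0) ∧
      1 / ((1 + ε) * a 1) < v ∧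
      v < (1 + ε) * a 1 / ((1 + ε) ^ 2 * a 1 ^ 2 - 2 * (1 + 2 * ε) * a 2) := by
  have hab := besselBounded_of_mem_closure ha
  have hcont := hab.continuous_eulerSeries ε
  set s₂ := a 1 ^ 2 - 2 * a 2 with hs₂
  have hs₂pos : 0 < s₂ := by linarith
  -- At `t = u` the Cauchy–Schwarz lower bound `s₁²/(s₁ - s₂ t)` for `-F'/F` equals `1/(ε t)`, which
  -- forces `F + ε t F' ≤ 0`.
  set u := a 1 / (ε * a 1 ^ 2 + s₂) with hu
  have hden : 0 < ε * a 1 ^ 2 + s₂ := by positivity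
  have hupos : 0 < u := by positivity
  have hex : ∃ v, 0 < v ∧ v ≤ u ∧ eulerSeries a ε v = 0 := by
    by_contra! hno
    have hH : ∀ t ∈ Set.Icc 0 u, 0 < eulerSeries a ε t := by
      intro t ht
      by_contra! hle
      obtain ⟨v, hv, hvt, hv0⟩ := eulerSeries_exists_root hab h0 ht.1 hle
      exact hno v hv (hvt.trans ht.2) hv0
    have hF := altSeriesReal_pos_of_eulerSeries_pos hab h0 hε
      (fun t ht => (hH t ⟨ht.1.le, ht.2.le⟩).le)
    -- This `c` is the optimal tangent point `s₁/(s₁ - s₂ u)`, simplified by the equation defining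
    -- `u`.
    have h3 := (closure_rootedCoeffs_inequalities ha hupos.le hF).2.2.1 (1 / (ε * a 1 * u))
    have h4 : 2 * (1 / (ε * a 1 * u)) * a 1 - (1 / (ε * a 1 * u)) ^ 2 * (a 1 - s₂ * u) =
        1 / (ε * u) := by
      have : a 1 - s₂ * u = ε * a 1 ^ 2 * u := by
        rw [hu]; field_simp; ring
      rw [this]; field_simp; norm_num
    rw [← hs₂, h4] at h3
    have h5 := hH u ⟨hupos.le, le_rfl⟩
    rw [mul_one_div, div_le_iff₀ (by positivity)] at h3
    rw [eulerSeries] at h5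
    linarith
  obtain ⟨v₁, hv₁, hv₁u, hv₁0⟩ := hex
  obtain ⟨v, ⟨hvI, hv0⟩, hvmin⟩ := (isCompact_Icc.inter_right
    (isClosed_eq hcont continuous_const : IsClosed {t | eulerSeries a ε t = 0})).exists_isLeast
    ⟨v₁, (⟨hv₁.le, hv₁u⟩ : v₁ ∈ Set.Icc 0 u), hv₁0⟩
  have hv0' : eulerSeries a ε v = 0 := hv0
  have hvpos : 0 < v := by
    refine lt_of_le_of_ne hvI.1 ?_
    rintro rfl
    rw [eulerSeries_zero h0] at hv0'
    exact one_ne_zero hv0'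
  have hleast : IsLeast {t | 0 < t ∧ eulerSeries a ε t = 0} v := by
    refine ⟨⟨hvpos, hv0'⟩, fun t ht => ?_⟩
    rcases le_total t u with h | h
    · exact hvmin ⟨⟨ht.1.le, h⟩, ht.2⟩
    · exact hvI.2.trans h
  have hHpos : ∀ t ∈ Set.Ico 0 v, 0 < eulerSeries a ε t := by
    intro t ht
    by_contra! hle
    obtain ⟨w, hw, hwt, hw0⟩ := eulerSeries_exists_root hab h0 ht.1 hle
    exact absurd (hleast.2 ⟨hw, hw0⟩) (not_le.2 (hwt.trans_lt ht.2))
  have hF := altSeriesReal_pos_of_eulerSeries_pos hab h0 hε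
    (fun t ht => (hHpos t ⟨ht.1.le, ht.2⟩).le)
  have hFv := hF v ⟨hvpos.le, le_rfl⟩
  have hroot : altSeriesReal a v = ε * v * -altSeriesReal (derivCoeff a) v := by
    rw [eulerSeries] at hv0'; linarith
  refine ⟨v, hleast, hF, hHpos, ?_, ?_, ?_⟩
  · have hev : ∀ᶠ t in 𝓝[>] v, 0 < altSeriesReal a t :=
      (hab.expBounded.continuous_real.continuousAt.tendsto.mono_left
        nhdsWithin_le_nhds).eventually_const_lt hFv
    obtain ⟨w, hw, hwF⟩ := (mem_nhdsGT_iff_exists_Ioo_subset).1 hev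
    have hFw : ∀ t ∈ Set.Ico 0 w, 0 < altSeriesReal a t := by
      intro t ht
      rcases le_or_gt t v with h | h
      · exact hF t ⟨ht.1, h⟩
      · exact hwF ⟨h, ht.2⟩
    refine ⟨w, hw, hFw, fun t ht => ?_⟩
    have htpos : 0 < t := hvpos.trans ht.1
    -- Since `-F'/F` does not decrease, `-ε v F'(t)/F(t) ≥ 1` for `t` slightly beyond `v`; replacing
    -- `v` by `t` makes this strict.
    have h4 := (closure_rootedCoeffs_inequalities ha htpos.le
      (fun x hx => hFw x ⟨hx.1, hx.2.trans_lt ht.2⟩)).2.2.2.1 v ⟨hvpos.le, ht.1.le⟩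
    have hFt := hFw t ⟨htpos.le, ht.2⟩
    have h5 := mul_le_mul_of_nonneg_left h4 (mul_pos hε hvpos).le
    rw [← mul_assoc, ← hroot, mul_left_comm] at h5
    have h6 := le_of_mul_le_mul_left h5 hFv
    have h7 : 0 < -altSeriesReal (derivCoeff a) t :=
      pos_of_mul_pos_right (hFt.trans_le h6) (by positivity)
    have h8 : ε * v * -altSeriesReal (derivCoeff a) t < ε * t * -altSeriesReal (derivCoeff a) t :=
      mul_lt_mul_of_pos_right (mul_lt_mul_of_pos_left ht.1 hε) h7
    rw [eulerSeries]
    linarith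
  · rw [div_lt_iff₀ (by positivity)]
    -- If `a_1 v ≥ 1` the bound is immediate. Otherwise the upper estimate of `-F'/F` at the zero
    -- `v`, weakened by `s₂ < a_1²`, collapses to `1 - a_1 v < ε a_1 v`.
    rcases lt_or_ge (a 1 * v) 1 with h | h
    · have h5 := (closure_rootedCoeffs_inequalities ha hvpos.le hF).2.2.2.2 h
      rw [← hs₂] at h5
      have hD : 0 < -altSeriesReal (derivCoeff a) v :=
        pos_of_mul_pos_right (hroot ▸ hFv) (by positivity)
      rw [hroot] at h5
      have h6 : 1 - a 1 * v ≤ ε * v * (a 1 * (1 - a 1 * v) + s₂ * v) := by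
        refine le_of_mul_le_mul_left (h5.trans_eq ?_) hD
        ring
      have h7 : ε * v * (a 1 * (1 - a 1 * v) + s₂ * v) <
          ε * v * (a 1 * (1 - a 1 * v) + a 1 ^ 2 * v) := by
        have : s₂ * v < a 1 ^ 2 * v := mul_lt_mul_of_pos_right (by linarith) hvpos
        have : 0 < ε * v := by positivity
        gcongr
      nlinarith
    · have : 0 < ε * (a 1 * v) := by positivity
      nlinarith
  -- The bound `v ≤ u` is already sharper than the stated one: cross-multiplication reduces the
  -- comparison to `s₂ < a_1²`, that is, to `a_2 > 0`.
  · refine hvI.2.trans_lt ?_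
    have hd2 : (1 + ε) ^ 2 * a 1 ^ 2 - 2 * (1 + 2 * ε) * a 2 =
        (1 + 2 * ε) * s₂ + ε ^ 2 * a 1 ^ 2 := by rw [hs₂]; ring
    rw [hd2, hu, div_lt_div_iff₀ hden (by positivity)]
    have : 0 < ε * a 1 * (a 2) := by positivity
    rw [hs₂]
    nlinarith

/-! ### The `q`-Bessel coefficients -/

/-- The coefficients of the `q`-Bessel series in the variable `(z / (2 (1 - q)))²`. -/
noncomputable def qCoeff (ν q : ℝ) (n : ℕ) : ℝ :=
  (1 - q) ^ (2 * n) * q ^ ((n : ℝ) * ((n : ℝ) + ν)) / (qPoch q q n * qPoch (q ^ (ν + 1)) q n)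

theorem qPoch_pos {a q : ℝ} (ha : 0 < a) (ha' : a < 1) (hq : 0 < q) (hq' : q < 1) (n : ℕ) :
    0 < qPoch a q n := by
  refine Finset.prod_pos fun k _ => ?_
  have : q ^ k ≤ 1 := pow_le_one₀ hq.le hq'.le
  nlinarith

theorem qCoeff_zero (ν q : ℝ) : qCoeff ν q 0 = 1 := by
  simp [qCoeff, qPoch]

section
variable {ν q : ℝ}

theorem qCoeff_pos (hν : 0 < ν) (hq : 0 < q) (hq' : q < 1) (n : ℕ) : 0 < qCoeff ν q n := by
  have h1 := qPoch_pos hq hq' hq hq' n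
  have h2 := qPoch_pos (Real.rpow_pos_of_pos hq (ν + 1))
    (Real.rpow_lt_one hq.le hq' (by linarith)) hq hq' n
  have h3 : 0 < 1 - q := by linarith
  have h4 := Real.rpow_pos_of_pos hq ((n : ℝ) * ((n : ℝ) + ν))
  unfold qCoeff
  positivity

theorem qCoeff_succ (hν : 0 < ν) (hq : 0 < q) (hq' : q < 1) (n : ℕ) :
    qCoeff ν q (n + 1) * ((1 - q ^ (n + 1)) * (1 - q ^ ν * q ^ (n + 1))) =
      (1 - q) ^ 2 * (q ^ ν * q ^ (2 * n + 1)) * qCoeff ν q n := by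
  have h1 := (qPoch_pos hq hq' hq hq' n).ne'
  have h2 := (qPoch_pos (Real.rpow_pos_of_pos hq (ν + 1))
    (Real.rpow_lt_one hq.le hq' (by linarith)) hq hq' n).ne'
  have h1' := (qPoch_pos hq hq' hq hq' (n + 1)).ne'
  have h2' := (qPoch_pos (Real.rpow_pos_of_pos hq (ν + 1))
    (Real.rpow_lt_one hq.le hq' (by linarith)) hq hq' (n + 1)).ne'
  have e1 : qPoch q q (n + 1) = qPoch q q n * (1 - q ^ (n + 1)) := by
    rw [qPoch, Finset.prod_range_succ, pow_succ' q n]; rfl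
  have e2 : qPoch (q ^ (ν + 1)) q (n + 1) =
      qPoch (q ^ (ν + 1)) q n * (1 - q ^ ν * q ^ (n + 1)) := by
    rw [qPoch, Finset.prod_range_succ, Real.rpow_add_one hq.ne', pow_succ' q n, mul_assoc]
    rfl
  have e3 : q ^ (((n + 1 : ℕ) : ℝ) * (((n + 1 : ℕ) : ℝ) + ν)) =
      q ^ ((n : ℝ) * ((n : ℝ) + ν)) * (q ^ ν * q ^ (2 * n + 1)) := by
    rw [← Real.rpow_natCast q (2 * n + 1), ← Real.rpow_add hq, ← Real.rpow_add hq]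
    congr 1
    push_cast
    ring
  rw [e1] at h1'
  rw [e2] at h2'
  have h3 := right_ne_zero_of_mul h1'
  have h4 := right_ne_zero_of_mul h2'
  rw [qCoeff, qCoeff, e1, e2, e3]
  field_simp
  ring

theorem one_sub_pow_succ_ge (hq : 0 < q) (hq' : q < 1) (n : ℕ) :
    (1 - q) * ((n + 1) * q ^ n) ≤ 1 - q ^ (n + 1) := by
  rw [← mul_neg_geom_sum q (n + 1)]
  refine mul_le_mul_of_nonneg_left ?_ (by linarith)
  have : ∑ i ∈ Finset.range (n + 1), q ^ n ≤ ∑ i ∈ Finset.range (n + 1), q ^ i :=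
    Finset.sum_le_sum fun i hi =>
      pow_le_pow_of_le_one hq.le hq'.le (Nat.lt_succ_iff.1 (Finset.mem_range.1 hi))
  simpa using this

/-- Both factors `1 - q^{n+1}` and `1 - q^{ν+n+1}` are at least `(1-q)(n+1)q^n`, so the ratio of
consecutive coefficients is at most `q^{ν+1}/(n+1)² ≤ 1/(n+1)²`. The bound is uniform in `q`, as the
limit `q ↗ 1` requires. -/
theorem qCoeff_le (hν : 0 < ν) (hq : 0 < q) (hq' : q < 1) (n : ℕ) :
    qCoeff ν q n ≤ 1 / (n.factorial : ℝ) ^ 2 := by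
  induction n with
  | zero => simp [qCoeff_zero]
  | succ n ih =>
    have hrec := qCoeff_succ hν hq hq' n
    have h1 := one_sub_pow_succ_ge hq hq' n
    have hQ0 : 0 < q ^ ν := Real.rpow_pos_of_pos hq ν
    have hQ1 : q ^ ν < 1 := Real.rpow_lt_one hq.le hq' hν
    have hqn : 0 < q ^ (n + 1) := by positivity
    have h0 : 0 < 1 - q := by linarith
    have hY : 0 < (1 - q) * (((n : ℝ) + 1) * q ^ n) := by positivity
    have h2 : (1 - q) * (((n : ℝ) + 1) * q ^ n) ≤ 1 - q ^ ν * q ^ (n + 1) := by nlinarith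
    have h3 := mul_le_mul h1 h2 hY.le (hY.le.trans h1)
    have hpos := qCoeff_pos hν hq hq' (n + 1)
    have hposn := qCoeff_pos hν hq hq' n
    have h4 := mul_le_mul_of_nonneg_left h3 hpos.le
    rw [hrec] at h4
    have h5 : q ^ ν * q ≤ 1 := by nlinarith
    have h6 : qCoeff ν q (n + 1) * ((n : ℝ) + 1) ^ 2 ≤ qCoeff ν q n := by
      have hc : 0 < (1 - q) ^ 2 * q ^ (2 * n) := by positivity
      refine le_of_mul_le_mul_left ?_ hc
      calc (1 - q) ^ 2 * q ^ (2 * n) * (qCoeff ν q (n + 1) * ((n : ℝ) + 1) ^ 2)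
          = qCoeff ν q (n + 1) *
            ((1 - q) * (((n : ℝ) + 1) * q ^ n) * ((1 - q) * (((n : ℝ) + 1) * q ^ n))) := by ring
        _ ≤ _ := h4
        _ = (1 - q) ^ 2 * q ^ (2 * n) * qCoeff ν q n * (q ^ ν * q) := by ring
        _ ≤ (1 - q) ^ 2 * q ^ (2 * n) * qCoeff ν q n * 1 := by gcongr
        _ = _ := by ring
    rw [Nat.factorial_succ]
    push_cast
    rw [le_div_iff₀ (by positivity)] at ih ⊢
    calc qCoeff ν q (n + 1) * (((n : ℝ) + 1) * n.factorial) ^ 2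
        = qCoeff ν q (n + 1) * ((n : ℝ) + 1) ^ 2 * (n.factorial : ℝ) ^ 2 := by ring
      _ ≤ qCoeff ν q n * (n.factorial : ℝ) ^ 2 := by gcongr
      _ ≤ 1 := ih

/-! ### `q`-Laguerre polynomials and the positivity of their zeros -/

/-- The product `∏_{i < k} (1 - x q^{-i})`. -/
noncomputable def truncFactor (q : ℝ) (k : ℕ) (x : ℝ) : ℝ := ∏ i ∈ Finset.range k, (1 - x / q ^ i)

theorem truncFactor_succ (k : ℕ) (x : ℝ) :
    truncFactor q (k + 1) x = truncFactor q k x * (1 - x / q ^ k) := by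
  rw [truncFactor, Finset.prod_range_succ]; rfl

/-- At `x = q^n` this is the shift of the degree from `n` to `n + 1`, which is what the recurrence
in `n` uses. -/
theorem truncFactor_succ_mul (hq : 0 < q) (k : ℕ) (x : ℝ) :
    truncFactor q (k + 1) (q * x) = (1 - q * x) * truncFactor q k x := by
  rw [truncFactor, Finset.prod_range_succ', mul_comm]
  congr 1
  · simp
  · refine Finset.prod_congr rfl fun i _ => ?_
    rw [pow_succ', mul_div_mul_left _ _ hq.ne']

theorem truncFactor_eq_zero (hq : 0 < q) {k n : ℕ} (h : n < k) :
    truncFactor q k (q ^ n) = 0 := by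
  refine Finset.prod_eq_zero (Finset.mem_range.2 h) ?_
  rw [div_self (by positivity), sub_self]

theorem truncFactor_mem_Icc (hq : 0 < q) (hq' : q < 1) (k n : ℕ) :
    truncFactor q k (q ^ n) ∈ Set.Icc (0 : ℝ) 1 := by
  rcases lt_or_ge n k with h | h
  · rw [truncFactor_eq_zero hq h]; simp
  · have hf : ∀ i ∈ Finset.range k, 0 ≤ 1 - q ^ n / q ^ i ∧ 1 - q ^ n / q ^ i ≤ 1 := by
      intro i hi
      have h1 : q ^ n / q ^ i ≤ 1 := by
        rw [div_le_one (by positivity)]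
        exact pow_le_pow_of_le_one hq.le hq'.le ((Finset.mem_range.1 hi).le.trans h)
      have h2 : 0 < q ^ n / q ^ i := by positivity
      constructor <;> linarith
    exact ⟨Finset.prod_nonneg fun i hi => (hf i hi).1,
      Finset.prod_le_one (fun i hi => (hf i hi).1) fun i hi => (hf i hi).2⟩

theorem tendsto_truncFactor (hq : 0 < q) (hq' : q < 1) (k : ℕ) :
    Tendsto (fun n : ℕ => truncFactor q k (q ^ n)) atTop (𝓝 1) := by
  have h := tendsto_finsetProd (Finset.range k) fun i _ =>
    ((tendsto_pow_atTop_nhds_zero_of_lt_one hq.le hq').div_const (q ^ i)).const_sub 1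
  simpa [truncFactor] using h

open Polynomial in
/-- The `q`-Laguerre polynomial with constant term `1`, in the scaled variable. -/
noncomputable def qLaguerre (ν q : ℝ) (n : ℕ) : ℝ[X] :=
  ∑ k ∈ Finset.range (n + 1), C ((-1) ^ k * (qCoeff ν q k * truncFactor q k (q ^ n))) * X ^ k

theorem coeff_qLaguerre (hq : 0 < q) (n k : ℕ) :
    (qLaguerre ν q n).coeff k = (-1) ^ k * (qCoeff ν q k * truncFactor q k (q ^ n)) := by
  rw [qLaguerre, Polynomial.finsetSum_coeff]
  simp only [Polynomial.coeff_C_mul_X_pow]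
  rw [Finset.sum_ite_eq]
  split_ifs with h
  · rfl
  · rw [truncFactor_eq_zero hq (by simpa using h)]; simp

open Polynomial in
-- Comparing coefficients of `X^{k+1}`, all terms become multiples of `qCoeff ν q (k+1)` times
-- `truncFactor q k (q^n)`, by `qCoeff_succ` and the shift rules. At `n = 0` the truncated index `n
-- - 1` is harmless because `1 - q^0 = 0`. The differences display the second-order operator of a
-- string.
theorem qLaguerre_recurrence (hν : 0 < ν) (hq : 0 < q) (hq' : q < 1) (n : ℕ) :
    C (1 - q ^ ν * q ^ (n + 1)) * (qLaguerre ν q (n + 1) - qLaguerre ν q n) =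
      C (q * (1 - q ^ n)) * (qLaguerre ν q n - qLaguerre ν q (n - 1)) -
        C ((1 - q) ^ 2 * (q ^ ν * q ^ (2 * n + 1))) * (X * qLaguerre ν q n) := by
  ext k
  simp only [coeff_sub, coeff_C_mul]
  cases k with
  | zero => simp [coeff_qLaguerre hq, qCoeff_zero, truncFactor]
  | succ k =>
    rw [coeff_X_mul]
    simp only [coeff_qLaguerre hq]
    have hA := qCoeff_succ hν hq hq' k
    have hqk : q ^ k ≠ 0 := by positivity
    have e1 : truncFactor q (k + 1) (q ^ (n + 1)) =
        (1 - q * q ^ n) * truncFactor q k (q ^ n) := by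
      rw [pow_succ' q n, truncFactor_succ_mul hq]
    have e2 := truncFactor_succ (q := q) k (q ^ n)
    have e3 : (1 - q ^ n) * truncFactor q (k + 1) (q ^ (n - 1)) =
        (1 - q ^ n / q ^ (k + 1)) * truncFactor q (k + 1) (q ^ n) := by
      cases n with
      | zero => rw [truncFactor_eq_zero hq (Nat.succ_pos k)]; simp
      | succ n =>
        rw [add_tsub_cancel_right, pow_succ' q n, truncFactor_succ_mul hq, truncFactor_succ,
          pow_succ' q k, mul_div_mul_left _ _ hq.ne']
        ring
    rw [e1]
    have e4 : q * (1 - q ^ n) * ((-1) ^ (k + 1) * (qCoeff ν q (k + 1) * truncFactor q (k + 1) (q ^ n))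
        - (-1) ^ (k + 1) * (qCoeff ν q (k + 1) * truncFactor q (k + 1) (q ^ (n - 1)))) =
        (-1) ^ (k + 1) * (qCoeff ν q (k + 1) * q) *
          ((1 - q ^ n) * truncFactor q (k + 1) (q ^ n) -
            (1 - q ^ n / q ^ (k + 1)) * truncFactor q (k + 1) (q ^ n)) := by
      rw [← e3]; ring
    rw [e4, e2]
    generalize truncFactor q k (q ^ n) = y at *
    generalize q ^ ν = Q at *
    rw [pow_succ q k] at hA ⊢
    have e5 : q ^ (2 * n + 1) = q * q ^ n * q ^ n := by ring
    have e6 : q ^ (2 * k + 1) = q * q ^ k * q ^ k := by ring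
    rw [e5]
    rw [e6] at hA
    rw [pow_succ q n]
    generalize q ^ n = x at *
    generalize q ^ k = t at *
    have hA' : (1 - q) ^ 2 * (Q * q) * qCoeff ν q k =
        qCoeff ν q (k + 1) * ((1 - t * q) * (1 - Q * (t * q))) / t ^ 2 := by
      rw [hA]; field_simp
    have e7 : (1 - q) ^ 2 * (Q * (q * x * x)) * ((-1) ^ k * (qCoeff ν q k * y)) =
        (-1) ^ k * x ^ 2 * y * ((1 - q) ^ 2 * (Q * q) * qCoeff ν q k) := by ring
    rw [e7, hA']
    field_simp
    ring

/-- A complex zero of the solution of a discrete Stieltjes string is real and positive. -/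
theorem string_zero_pos {l : ℕ → ℂ} {κ μ : ℕ → ℝ} {z : ℂ} (hκ : ∀ n, 0 < κ n) (hμ : ∀ n, 0 < μ n)
    (hl : l 0 = 1) (h0 : κ 0 * (l 1 - l 0) = -(z * μ 0 * l 0))
    (hrec : ∀ n, κ (n + 1) * (l (n + 2) - l (n + 1)) =
      κ n * (l (n + 1) - l n) - z * μ (n + 1) * l (n + 1))
    {N : ℕ} (hN : l N = 0) : ∃ x : ℝ, 0 < x ∧ z = x := by
  -- Summation by parts against the conjugate solution: the boundary term equals elastic energy
  -- minus `z` times the mass form. At a zero `l N = 0` the left side vanishes, so `z` is a Rayleigh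
  -- quotient.
  have key : ∀ n, κ n * (l (n + 1) - l n) * (starRingEnd ℂ) (l (n + 1)) =
      ((∑ i ∈ Finset.range (n + 1), κ i * Complex.normSq (l (i + 1) - l i) : ℝ) : ℂ) -
        z * ((∑ i ∈ Finset.range (n + 1), μ i * Complex.normSq (l i) : ℝ) : ℂ) := by
    have hsplit : ∀ n, κ n * (l (n + 1) - l n) * (starRingEnd ℂ) (l (n + 1)) =
        ((κ n * Complex.normSq (l (n + 1) - l n) : ℝ) : ℂ) +
          κ n * (l (n + 1) - l n) * (starRingEnd ℂ) (l n) := by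
      intro n
      rw [Complex.ofReal_mul, Complex.normSq_eq_conj_mul_self, map_sub]
      ring
    intro n
    induction n with
    | zero =>
      rw [hsplit, zero_add, h0]
      simp only [zero_add, Finset.sum_range_one]
      rw [Complex.ofReal_mul (μ 0), Complex.normSq_eq_conj_mul_self (z := l 0)]
      ring
    | succ n ih =>
      rw [hsplit, hrec, sub_mul, ih, Finset.sum_range_succ _ (n + 1), Finset.sum_range_succ _ (n + 1),
        Complex.ofReal_add, Complex.ofReal_add, Complex.ofReal_mul (μ (n + 1)),
        Complex.normSq_eq_conj_mul_self (z := l (n + 1))]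
      ring
  cases N with
  | zero => rw [hl] at hN; exact absurd hN one_ne_zero
  | succ N =>
    have h := key N
    rw [hN, map_zero, mul_zero] at h
    set S := ∑ i ∈ Finset.range (N + 1), κ i * Complex.normSq (l (i + 1) - l i)
    set T := ∑ i ∈ Finset.range (N + 1), μ i * Complex.normSq (l i)
    have hS : 0 ≤ S := Finset.sum_nonneg fun i _ => mul_nonneg (hκ i).le (Complex.normSq_nonneg _)
    have hT : 0 < T := by
      refine Finset.sum_pos' (fun i _ => mul_nonneg (hμ i).le (Complex.normSq_nonneg _))
        ⟨0, by simp, ?_⟩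
      rw [hl, map_one, mul_one]
      exact hμ 0
    have hz : z = ((S / T : ℝ) : ℂ) := by
      rw [Complex.ofReal_div, eq_div_iff (by exact_mod_cast hT.ne')]
      linear_combination h
    refine ⟨S / T, lt_of_le_of_ne (by positivity) fun hne => ?_, hz⟩
    rw [← hne, Complex.ofReal_zero] at hz
    -- For `z = 0` the recurrence keeps all increments zero, so the solution is constantly `1` and
    -- cannot vanish.
    have hcon : ∀ n, l n = 1 ∧ l (n + 1) = 1 := by
      intro n
      induction n with
      | zero =>
        rw [hz, zero_mul, zero_mul, neg_zero, mul_eq_zero] at h0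
        have := h0.resolve_left (by exact_mod_cast (hκ 0).ne')
        exact ⟨hl, by linear_combination this + hl⟩
      | succ n ih =>
        have h1 := hrec n
        rw [hz, zero_mul, zero_mul, ih.1, ih.2, sub_self, mul_zero, sub_zero, mul_eq_zero] at h1
        have := h1.resolve_left (by exact_mod_cast (hκ _).ne')
        exact ⟨ih.2, by linear_combination this⟩
    rw [(hcon N).2] at hN
    exact one_ne_zero hN

open Polynomial in
theorem qLaguerre_root_pos (hν : 0 < ν) (hq : 0 < q) (hq' : q < 1) {N : ℕ} {z : ℂ}
    (hz : aeval z (qLaguerre ν q N) = 0) : ∃ x : ℝ, 0 < x ∧ z = x := by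
  have hQ0 : 0 < q ^ ν := Real.rpow_pos_of_pos hq ν
  have hQ1 : q ^ ν < 1 := Real.rpow_lt_one hq.le hq' hν
  have hq1 : ∀ n : ℕ, q ^ (n + 1) < 1 := fun n => pow_lt_one₀ hq.le hq' (Nat.succ_ne_zero n)
  have hA : ∀ n : ℕ, 0 < 1 - q ^ ν * q ^ (n + 1) := fun n => by
    have := hq1 n
    have : 0 < q ^ (n + 1) := by positivity
    nlinarith
  have hC : ∀ n : ℕ, 0 < q * (1 - q ^ (n + 1)) := fun n => mul_pos hq (by linarith [hq1 n])
  -- Symmetrizing weights: after multiplication by `w n`, the coefficient of the backward difference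
  -- at `n + 1` equals that of the forward difference at `n`, as the string requires.
  let w : ℕ → ℝ := fun n => ∏ i ∈ Finset.range n,
    ((1 - q ^ ν * q ^ (i + 1)) / (q * (1 - q ^ (i + 1))))
  have hw : ∀ n, 0 < w n := fun n => Finset.prod_pos fun i _ => div_pos (hA i) (hC i)
  have hwsucc : ∀ n, w (n + 1) * (q * (1 - q ^ (n + 1))) = w n * (1 - q ^ ν * q ^ (n + 1)) := by
    intro n
    simp only [w]
    rw [Finset.prod_range_succ, mul_assoc, div_mul_cancel₀ _ (hC n).ne']
  have hrec : ∀ n, ((1 - q ^ ν * q ^ (n + 1) : ℝ) : ℂ) *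
      (aeval z (qLaguerre ν q (n + 1)) - aeval z (qLaguerre ν q n)) =
      ((q * (1 - q ^ n) : ℝ) : ℂ) *
        (aeval z (qLaguerre ν q n) - aeval z (qLaguerre ν q (n - 1))) -
      (((1 - q) ^ 2 * (q ^ ν * q ^ (2 * n + 1)) : ℝ) : ℂ) * (z * aeval z (qLaguerre ν q n)) := by
    intro n
    have h := congrArg (aeval z) (qLaguerre_recurrence hν hq hq' n)
    simpa only [map_sub (aeval z : ℝ[X] →ₐ[ℝ] ℂ), map_mul (aeval z : ℝ[X] →ₐ[ℝ] ℂ), aeval_C, aeval_X, Complex.coe_algebraMap]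
      using h
  have h1q : 0 < 1 - q := by linarith
  refine string_zero_pos (l := fun n => aeval z (qLaguerre ν q n))
    (κ := fun n => w n * (1 - q ^ ν * q ^ (n + 1)))
    (μ := fun n => w n * ((1 - q) ^ 2 * (q ^ ν * q ^ (2 * n + 1)))) (fun n => mul_pos (hw n) (hA n))
    (fun n => mul_pos (hw n) (by positivity)) ?_ ?_ ?_ hz
  · simp [qLaguerre, qCoeff_zero, truncFactor]
  · have h := hrec 0
    simp only [pow_zero, sub_self, mul_zero, Complex.ofReal_zero, zero_sub] at h
    simp only [Complex.ofReal_mul (w 0)]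
    rw [mul_assoc, zero_add, h]
    ring_nf
  · intro n
    have h := hrec (n + 1)
    rw [add_tsub_cancel_right] at h
    have h2 : ((w n * (1 - q ^ ν * q ^ (n + 1)) : ℝ) : ℂ) =
        (w (n + 1) : ℂ) * ((q * (1 - q ^ (n + 1)) : ℝ) : ℂ) := by
      rw [← hwsucc, Complex.ofReal_mul]
    simp only [h2]
    rw [Complex.ofReal_mul (w (n + 1)), Complex.ofReal_mul (w (n + 1)), mul_assoc, h]
    ring

open Polynomial in
/-- A real polynomial with constant term `1` all of whose complex roots are positive is a product
of factors `1 - x X` with `x ≥ 0`. -/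
theorem exists_eq_reciprocalRootPoly {p : ℝ[X]} (h0 : p.coeff 0 = 1)
    (h : ∀ z : ℂ, aeval z p = 0 → ∃ x : ℝ, 0 < x ∧ z = x) :
    ∃ s : Multiset ℝ, (∀ x ∈ s, 0 ≤ x) ∧ p = reciprocalRootPoly s := by
  set P : ℂ[X] := p.map (algebraMap ℝ ℂ) with hP
  have hP0 : P.coeff 0 = 1 := by rw [hP, coeff_map, h0, map_one]
  have hPne : P ≠ 0 := fun h => by rw [h] at hP0; simp at hP0
  have hroot : ∀ z ∈ P.roots, ∃ x : ℝ, 0 < x ∧ z = x := fun z hz => by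
    refine h z ?_
    have := isRoot_of_mem_roots hz
    rwa [IsRoot, hP, eval_map_algebraMap] at this
  refine ⟨P.roots.map fun z => z.re⁻¹, ?_, ?_⟩
  · intro x hx
    obtain ⟨z, hz, rfl⟩ := Multiset.mem_map.1 hx
    obtain ⟨y, hy, rfl⟩ := hroot z hz
    simpa using hy.le
  · refine map_injective (algebraMap ℝ ℂ) Complex.ofReal_injective ?_
    have e1 : (reciprocalRootPoly (P.roots.map fun z => z.re⁻¹)).map (algebraMap ℝ ℂ) =
        (P.roots.map fun z => 1 - C z⁻¹ * X).prod := by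
      rw [reciprocalRootPoly, Polynomial.map_multiset_prod, Multiset.map_map, Multiset.map_map]
      refine congrArg Multiset.prod (Multiset.map_congr rfl fun z hz => ?_)
      obtain ⟨y, hy, rfl⟩ := hroot z hz
      simp
    have e2 : (P.roots.map fun z => X - C z).prod =
        C (P.roots.map fun z => -z).prod * (P.roots.map fun z => 1 - C z⁻¹ * X).prod := by
      rw [map_multiset_prod, Multiset.map_map, ← Multiset.prod_map_mul]
      refine congrArg Multiset.prod (Multiset.map_congr rfl fun z hz => ?_)
      obtain ⟨y, hy, rfl⟩ := hroot z hz
      have hy' : (y : ℂ) ≠ 0 := by exact_mod_cast hy.ne'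
      have : (C (y : ℂ)) * C (y : ℂ)⁻¹ = 1 := by rw [← C_mul, mul_inv_cancel₀ hy', C_1]
      simp only [Function.comp, map_neg]
      linear_combination (-X) * this
    -- The leading coefficient times `∏ (-z)` over the roots is the constant term of `P`, which is
    -- `1`.
    have e3 := (IsAlgClosed.splits P).eq_prod_roots
    rw [e2, ← mul_assoc, ← C_mul] at e3
    have e4 : ((P.roots.map fun z => 1 - C z⁻¹ * X).prod).coeff 0 = 1 := by
      rw [coeff_zero_eq_eval_zero, eval_multiset_prod, Multiset.map_map]
      simp
    have e5 := congrArg (fun f => coeff f 0) e3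
    simp only [hP0, coeff_C_mul, e4, mul_one] at e5
    rw [← e5, C_1, one_mul] at e3
    rw [e1, ← e3]

theorem qCoeff_besselBounded (hν : 0 < ν) (hq : 0 < q) (hq' : q < 1) :
    BesselBounded (qCoeff ν q) := fun n => by
  rw [abs_of_pos (qCoeff_pos hν hq hq' n)]
  exact qCoeff_le hν hq hq' n

/-- The approximants are the `q`-Laguerre polynomials of degree index `N → ∞`: their truncation
factors lie in `[0, 1]`, which preserves the coefficient bound, and tend to `1`. -/
theorem qCoeff_mem_closure (hν : 0 < ν) (hq : 0 < q) (hq' : q < 1) :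
    qCoeff ν q ∈ closure rootedCoeffs := by
  refine mem_closure_of_tendsto
    (f := fun N k => qCoeff ν q k * truncFactor q k (q ^ N)) (b := atTop)
    (tendsto_pi_nhds.2 fun k => ?_) (Eventually.of_forall fun N => ⟨fun k => ?_, ?_⟩)
  · simpa using (tendsto_truncFactor hq hq' k).const_mul (qCoeff ν q k)
  · obtain ⟨h1, h2⟩ := truncFactor_mem_Icc hq hq' k N
    have h3 := qCoeff_pos hν hq hq' k
    rw [abs_of_nonneg (mul_nonneg h3.le h1)]
    exact (mul_le_of_le_one_right h3.le h2).trans (qCoeff_le hν hq hq' k)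
  · obtain ⟨s, hs, h⟩ := exists_eq_reciprocalRootPoly (p := qLaguerre ν q N)
      (by rw [coeff_qLaguerre hq]; simp [qCoeff_zero, truncFactor])
      (fun z hz => qLaguerre_root_pos hν hq hq' hz)
    exact ⟨s, hs, fun n => by rw [← h, coeff_qLaguerre hq]⟩

end

/-! ### The limit `q ↗ 1` and continuity of the least zero -/

/-- The coefficients of the classical Bessel series in the variable `(z / 2)²`. -/
noncomputable def besselCoeff (ν : ℝ) (n : ℕ) : ℝ :=
  1 / ((n.factorial : ℝ) * ∏ k ∈ Finset.range n, (ν + 1 + k))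

theorem tendsto_one_sub_rpow_div (s : ℝ) :
    Tendsto (fun q : ℝ => (1 - q ^ s) / (1 - q)) (𝓝[<] 1) (𝓝 s) := by
  have h := (Real.hasDerivAt_rpow_const (x := 1) (p := s) (Or.inl one_ne_zero)).tendsto_slope
  rw [Real.one_rpow, mul_one] at h
  refine (h.mono_left (nhdsWithin_mono _ fun x hx => ne_of_lt hx)).congr fun q => ?_
  rw [slope_def_field, Real.one_rpow, ← neg_sub, ← neg_sub 1 q, neg_div_neg_eq]

theorem eventually_mem_Ioo : ∀ᶠ q : ℝ in 𝓝[<] 1, 0 < q ∧ q < 1 :=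
  Ioo_mem_nhdsLT one_pos

theorem tendsto_qCoeff {ν : ℝ} (hν : 0 < ν) : Tendsto (qCoeff ν) (𝓝[<] 1) (𝓝 (besselCoeff ν)) := by
  refine tendsto_pi_nhds.2 fun n => ?_
  have h1 : Tendsto (fun q : ℝ => ∏ k ∈ Finset.range n, (1 - q ^ ((k : ℝ) + 1)) / (1 - q)) (𝓝[<] 1)
      (𝓝 (n.factorial : ℝ)) := by
    have := tendsto_finsetProd (Finset.range n) fun k _ => tendsto_one_sub_rpow_div ((k : ℝ) + 1)
    rw [← Finset.prod_range_add_one_eq_factorial]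
    push_cast
    exact this
  have h2 := tendsto_finsetProd (Finset.range n) fun k _ => tendsto_one_sub_rpow_div (ν + 1 + k)
  have h3 : Tendsto (fun q : ℝ => q ^ ((n : ℝ) * ((n : ℝ) + ν))) (𝓝[<] 1) (𝓝 1) := by
    have := (Real.continuousAt_rpow_const 1 ((n : ℝ) * ((n : ℝ) + ν))
      (Or.inl one_ne_zero)).tendsto
    rw [Real.one_rpow] at this
    exact this.mono_left nhdsWithin_le_nhds
  have hne : (n.factorial : ℝ) * ∏ k ∈ Finset.range n, (ν + 1 + k) ≠ 0 := by positivity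
  refine (h3.div (h1.mul h2) hne).congr' ?_
  filter_upwards [eventually_mem_Ioo] with q hq
  have hq1 : 0 < 1 - q := by linarith [hq.2]
  have e1 : qPoch q q n = ∏ k ∈ Finset.range n, (1 - q ^ ((k : ℝ) + 1)) := by
    refine Finset.prod_congr rfl fun k _ => ?_
    rw [Real.rpow_add_one hq.1.ne', Real.rpow_natCast, mul_comm]
  have e2 : qPoch (q ^ (ν + 1)) q n = ∏ k ∈ Finset.range n, (1 - q ^ (ν + 1 + k)) := by
    refine Finset.prod_congr rfl fun k _ => ?_
    rw [Real.rpow_add hq.1 (ν + 1), Real.rpow_natCast]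
  have hp1 := (qPoch_pos hq.1 hq.2 hq.1 hq.2 n).ne'
  have hp2 := (qPoch_pos (Real.rpow_pos_of_pos hq.1 (ν + 1))
    (Real.rpow_lt_one hq.1.le hq.2 (by linarith)) hq.1 hq.2 n).ne'
  simp only [Pi.div_apply, Finset.prod_div_distrib, Finset.prod_const, Finset.card_range]
  rw [qCoeff, ← e1, ← e2]
  field_simp
  ring

theorem besselCoeff_mem_closure {ν : ℝ} (hν : 0 < ν) : besselCoeff ν ∈ closure rootedCoeffs :=
  isClosed_closure.mem_of_tendsto (tendsto_qCoeff hν)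
    (eventually_mem_Ioo.mono fun _ hq => qCoeff_mem_closure hν hq.1 hq.2)

theorem abs_eulerSeries_sub_le {a b : ℕ → ℝ} (ha : BesselBounded a) (hb : BesselBounded b)
    {ε r t : ℝ} (hε : 0 ≤ ε) (ht : t ∈ Set.Icc 0 r) :
    |eulerSeries a ε t - eulerSeries b ε t| ≤
      coeffDist a b r + ε * r * coeffDist (derivCoeff a) (derivCoeff b) r := by
  have htr : |t| ≤ r := by rw [abs_of_nonneg ht.1]; exact ht.2
  have h1 := abs_altSeriesReal_sub_le ha.expBounded hb.expBounded htr
  have h2 := abs_altSeriesReal_sub_le ha.expBounded_derivCoeff hb.expBounded_derivCoeff htr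
  have h3 : eulerSeries a ε t - eulerSeries b ε t = (altSeriesReal a t - altSeriesReal b t) +
      ε * t * (altSeriesReal (derivCoeff a) t - altSeriesReal (derivCoeff b) t) := by
    rw [eulerSeries, eulerSeries]; ring
  rw [h3]
  refine (abs_add_le _ _).trans (add_le_add h1 ?_)
  rw [abs_mul, abs_of_nonneg (mul_nonneg hε ht.1)]
  exact mul_le_mul (mul_le_mul_of_nonneg_left ht.2 hε) h2 (abs_nonneg _)
    (mul_nonneg hε (ht.1.trans ht.2))

/-- Uniform closeness does two things: a positive minimum on `[0, v₁]`, `v₁ < v₀`, excludes early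
zeros of the approximants, and a negative value just beyond `v₀` forces a zero before that point. -/
theorem tendsto_isLeast_eulerSeries {ι : Type*} {l : Filter ι} {b : ι → ℕ → ℝ} {a : ℕ → ℝ}
    (hb : ∀ᶠ i in l, BesselBounded (b i)) (hb0 : ∀ᶠ i in l, b i 0 = 1) (ha : BesselBounded a)
    (h : Tendsto b l (𝓝 a)) {ε : ℝ} (hε : 0 ≤ ε) {v : ι → ℝ} {v₀ w : ℝ} (hv₀ : 0 < v₀)
    (hv : ∀ᶠ i in l, IsLeast {t | 0 < t ∧ eulerSeries (b i) ε t = 0} (v i))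
    (hpos : ∀ t ∈ Set.Ico 0 v₀, 0 < eulerSeries a ε t) (hw : v₀ < w)
    (hneg : ∀ t ∈ Set.Ioo v₀ w, eulerSeries a ε t < 0) : Tendsto v l (𝓝 v₀) := by
  have hdist : ∀ r, 0 ≤ r → Tendsto (fun i => coeffDist (b i) a r +
      ε * r * coeffDist (derivCoeff (b i)) (derivCoeff a) r) l (𝓝 0) := by
    intro r hr
    have h1 := tendsto_coeffDist (hb.mono fun _ h => h.expBounded) ha.expBounded h hr
    have h2 := tendsto_coeffDist (hb.mono fun _ h => h.expBounded_derivCoeff)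
      ha.expBounded_derivCoeff (tendsto_derivCoeff h) hr
    simpa using h1.add (h2.const_mul (ε * r))
  rw [tendsto_order]
  constructor
  · intro v₁ hv₁
    rcases lt_or_ge v₁ 0 with h0 | h0
    · filter_upwards [hv] with i hi
      exact h0.trans hi.1.1
    · obtain ⟨m, hm, hmin⟩ := isCompact_Icc.exists_isMinOn (Set.nonempty_Icc.2 h0)
        (ha.continuous_eulerSeries ε).continuousOn
      have hmpos := hpos m ⟨hm.1, hm.2.trans_lt hv₁⟩
      filter_upwards [hv, hb, (hdist v₁ h0).eventually_lt_const hmpos] with i hi hbi hdi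
      by_contra! hle
      have h1 := abs_eulerSeries_sub_le hbi ha hε (show v i ∈ Set.Icc 0 v₁ from ⟨hi.1.1.le, hle⟩)
      have h2 : eulerSeries a ε m ≤ eulerSeries a ε (v i) := hmin ⟨hi.1.1.le, hle⟩
      rw [hi.1.2] at h1
      linarith [(abs_le.1 h1).1]
  · intro v₂ hv₂
    obtain ⟨t, ht1, ht2⟩ := exists_between (lt_min hw hv₂)
    have ht0 : 0 ≤ t := (hv₀.trans ht1).le
    have htneg := hneg t ⟨ht1, ht2.trans_le (min_le_left _ _)⟩
    filter_upwards [hv, hb, hb0, (hdist t ht0).eventually_lt_const (neg_pos.2 htneg)] with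
      i hi hbi hbi0 hdi
    have h1 := abs_eulerSeries_sub_le hbi ha hε (show t ∈ Set.Icc 0 t from ⟨ht0, le_rfl⟩)
    obtain ⟨x, hx, hxt, hx0⟩ := eulerSeries_exists_root hbi hbi0 ht0
      (show eulerSeries (b i) ε t ≤ 0 by linarith [(abs_le.1 h1).2])
    exact (hi.2 ⟨hx, hx0⟩).trans_lt (hxt.trans_lt (ht2.trans_le (min_le_right _ _)))

/-! ### The first coefficients and the explicit bounds -/

theorem besselCoeff_zero (ν : ℝ) : besselCoeff ν 0 = 1 := by simp [besselCoeff]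

theorem besselCoeff_one (ν : ℝ) : besselCoeff ν 1 = 1 / (ν + 1) := by simp [besselCoeff]

theorem besselCoeff_two (ν : ℝ) : besselCoeff ν 2 = 1 / (2 * ((ν + 1) * (ν + 2))) := by
  rw [besselCoeff, Finset.prod_range_succ, Finset.prod_range_one]
  simp only [Nat.factorial_two, Nat.cast_ofNat, Nat.cast_zero, Nat.cast_one, add_zero]
  ring

theorem two_mul_besselCoeff_two_lt {ν : ℝ} (hν : 0 < ν) :
    2 * besselCoeff ν 2 < besselCoeff ν 1 ^ 2 := by
  rw [besselCoeff_one, besselCoeff_two, div_pow, mul_one_div, div_lt_div_iff₀ (by positivity)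
    (by positivity)]
  nlinarith

section
variable {ν q : ℝ}

theorem one_sub_rpow_mul_pow_pos (hν : 0 < ν) (hq : 0 < q) (hq' : q < 1) (n : ℕ) :
    0 < 1 - q ^ ν * q ^ n := by
  have h1 : 0 < q ^ ν := Real.rpow_pos_of_pos hq ν
  have h2 : q ^ ν < 1 := Real.rpow_lt_one hq.le hq' hν
  have h3 : q ^ n ≤ 1 := pow_le_one₀ hq.le hq'.le
  have h4 : 0 < q ^ n := by positivity
  nlinarith

theorem qCoeff_one (hν : 0 < ν) (hq : 0 < q) (hq' : q < 1) :
    qCoeff ν q 1 = (1 - q) * (q ^ ν * q) / (1 - q ^ ν * q) := by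
  have h := qCoeff_succ hν hq hq' 0
  have h1 := one_sub_rpow_mul_pow_pos hν hq hq' 1
  have h2 : 0 < 1 - q := by linarith
  simp only [zero_add, mul_zero, pow_one, qCoeff_zero, mul_one] at h h1
  rw [eq_div_iff h1.ne']
  refine mul_left_cancel₀ h2.ne' ?_
  linear_combination h

theorem qCoeff_two (hν : 0 < ν) (hq : 0 < q) (hq' : q < 1) :
    qCoeff ν q 2 =
      qCoeff ν q 1 ^ 2 * (q ^ 2 * (1 - q ^ ν * q)) / ((1 + q) * (1 - q ^ ν * q ^ 2)) := by
  have h := qCoeff_succ hν hq hq' 1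
  have h1 := one_sub_rpow_mul_pow_pos hν hq hq' 1
  have h2 := one_sub_rpow_mul_pow_pos hν hq hq' 2
  have h3 : 0 < 1 - q := by linarith
  have h4 : qCoeff ν q 1 * (1 - q ^ ν * q) = (1 - q) * (q ^ ν * q) := by
    rw [pow_one] at h1
    rw [qCoeff_one hν hq hq', div_mul_cancel₀ _ h1.ne']
  norm_num at h
  rw [eq_div_iff (by positivity)]
  refine mul_left_cancel₀ h3.ne' ?_
  linear_combination h - (1 - q) * q ^ 2 * qCoeff ν q 1 * h4

theorem two_mul_qCoeff_two_lt (hν : 0 < ν) (hq : 0 < q) (hq' : q < 1) :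
    2 * qCoeff ν q 2 < qCoeff ν q 1 ^ 2 := by
  have h1 := one_sub_rpow_mul_pow_pos hν hq hq' 1
  have h2 := one_sub_rpow_mul_pow_pos hν hq hq' 2
  have h3 := qCoeff_pos hν hq hq' 1
  have hQ : 0 < q ^ ν := Real.rpow_pos_of_pos hq ν
  rw [pow_one] at h1
  -- After dividing by `a_1²` this is the claim; it splits into `2q² < 1 + q` and `1 - q^{ν+1} ≤ 1 -
  -- q^{ν+2}`.
  have h4 : 2 * (q ^ 2 * (1 - q ^ ν * q)) < (1 + q) * (1 - q ^ ν * q ^ 2) := by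
    have h5 : 1 - q ^ ν * q ≤ 1 - q ^ ν * q ^ 2 := by
      have : 0 < q ^ ν * q * (1 - q) := mul_pos (mul_pos hQ hq) (by linarith)
      nlinarith
    have h6 : 2 * q ^ 2 < 1 + q := by nlinarith
    nlinarith [mul_lt_mul_of_pos_right h6 h1]
  rw [qCoeff_two hν hq hq', ← mul_div_assoc, div_lt_iff₀ (by positivity)]
  have := mul_lt_mul_of_pos_left h4 (pow_pos h3 2)
  linarith

theorem lowerBound_eq (hν : 0 < ν) (hq : 0 < q) (hq' : q < 1) :
    lowerBound ν q = 4 * (1 - q) ^ 2 * (1 / ((1 + 2 / ν) * qCoeff ν q 1)) := by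
  have h1 := one_sub_rpow_mul_pow_pos hν hq hq' 1
  have h3 : 0 < 1 - q := by linarith
  have hQ : 0 < q ^ ν := Real.rpow_pos_of_pos hq ν
  rw [pow_one] at h1
  rw [lowerBound, qCoeff_one hν hq hq', Real.rpow_add_one hq.ne']
  field_simp

theorem upperBound_eq (hν : 0 < ν) (hq : 0 < q) (hq' : q < 1) :
    upperBound ν q = 4 * (1 - q) ^ 2 * ((1 + 2 / ν) * qCoeff ν q 1 /
      ((1 + 2 / ν) ^ 2 * qCoeff ν q 1 ^ 2 - 2 * (1 + 2 * (2 / ν)) * qCoeff ν q 2)) := by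
  have h1 := one_sub_rpow_mul_pow_pos hν hq hq' 1
  have h2 := one_sub_rpow_mul_pow_pos hν hq hq' 2
  have h3 : 0 < 1 - q := by linarith
  have h4 := qCoeff_pos hν hq hq' 1
  have h5 := two_mul_qCoeff_two_lt hν hq hq'
  have hQ : 0 < q ^ ν := Real.rpow_pos_of_pos hq ν
  rw [pow_one] at h1
  have e2 : q ^ (ν + 2) = q ^ ν * q ^ 2 := by
    rw [Real.rpow_add hq, Real.rpow_ofNat]
  have e3 : q ^ (ν + 3) = q ^ ν * q ^ 3 := by
    rw [Real.rpow_add hq, Real.rpow_ofNat]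
  set D := (ν + 2) ^ 2 * (1 + q - q ^ (ν + 2)) - 2 * ν * (ν + 4) * q ^ 2 +
      (ν ^ 2 + 4 * ν - 4) * q ^ (ν + 3) with hD
  have hden : (1 + 2 / ν) ^ 2 * qCoeff ν q 1 ^ 2 - 2 * (1 + 2 * (2 / ν)) * qCoeff ν q 2 =
      qCoeff ν q 1 ^ 2 * D / (ν ^ 2 * ((1 + q) * (1 - q ^ ν * q ^ 2))) := by
    have hc : qCoeff ν q 2 * ((1 + q) * (1 - q ^ ν * q ^ 2)) =
        qCoeff ν q 1 ^ 2 * (q ^ 2 * (1 - q ^ ν * q)) := by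
      rw [qCoeff_two hν hq hq', div_mul_cancel₀ _ (by positivity)]
    rw [eq_div_iff (by positivity), hD, e2, e3]
    have hν' : ν * (2 / ν) = 2 := by field_simp
    generalize 2 / ν = ε at *
    linear_combination (-2 * ν * (ν + 4)) * hc + ((qCoeff ν q 1 ^ 2 * (2 * ν + ν * ε + 2) -
      4 * ν * qCoeff ν q 2) * ((1 + q) * (1 - q ^ ν * q ^ 2))) * hν'
  -- With `ε = 2/ν` the expression is `(1 + 2ε)(a_1² - 2a_2) + ε² a_1²`. Its positivity shows that
  -- the denominator in `upperBound` does not vanish.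
  have hpos : 0 < (1 + 2 / ν) ^ 2 * qCoeff ν q 1 ^ 2 - 2 * (1 + 2 * (2 / ν)) * qCoeff ν q 2 := by
    have : 0 < 2 / ν := by positivity
    nlinarith [mul_pos this (sub_pos.2 h5), sq_nonneg (2 / ν * qCoeff ν q 1)]
  have hDne : D ≠ 0 := fun h => by rw [hden, h] at hpos; simp at hpos
  rw [hden, upperBound, ← hD, e2, Real.rpow_add_one hq.ne']
  rw [qCoeff_one hν hq hq']
  field_simp
  ring

theorem tendsto_lowerBound (hν : 0 < ν) :
    Tendsto (fun q : ℝ => lowerBound ν q / (1 - q) ^ 2) (𝓝[<] 1)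
      (𝓝 (4 * ν * (ν + 1) / (ν + 2))) := by
  have h1 := tendsto_pi_nhds.1 (tendsto_qCoeff hν) 1
  rw [besselCoeff_one] at h1
  have h2 := ((h1.const_mul (1 + 2 / ν)).inv₀ (by positivity)).const_mul 4
  have e : 4 * ((1 + 2 / ν) * (1 / (ν + 1)))⁻¹ = 4 * ν * (ν + 1) / (ν + 2) := by field_simp
  rw [e] at h2
  refine h2.congr' ?_
  filter_upwards [eventually_mem_Ioo] with q hq
  have : 0 < 1 - q := by linarith [hq.2]
  rw [lowerBound_eq hν hq.1 hq.2]
  field_simp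

theorem besselCoeff_upper_eq (hν : 0 < ν) :
    4 * ((1 + 2 / ν) * besselCoeff ν 1 / ((1 + 2 / ν) ^ 2 * besselCoeff ν 1 ^ 2 -
      2 * (1 + 2 * (2 / ν)) * besselCoeff ν 2)) =
    4 * ν * (ν + 1) * (ν + 2) ^ 2 / (ν ^ 2 + 8 * ν + 8) := by
  have hden : (1 + 2 / ν) ^ 2 * besselCoeff ν 1 ^ 2 - 2 * (1 + 2 * (2 / ν)) * besselCoeff ν 2 =
      (ν ^ 2 + 8 * ν + 8) / (ν ^ 2 * (ν + 1) ^ 2 * (ν + 2)) := by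
    rw [besselCoeff_one, besselCoeff_two]
    field_simp
    ring
  rw [hden, besselCoeff_one]
  field_simp

theorem tendsto_upperBound (hν : 0 < ν) :
    Tendsto (fun q : ℝ => upperBound ν q / (1 - q) ^ 2) (𝓝[<] 1)
      (𝓝 (4 * ν * (ν + 1) * (ν + 2) ^ 2 / (ν ^ 2 + 8 * ν + 8))) := by
  have h1 := tendsto_pi_nhds.1 (tendsto_qCoeff hν) 1
  have h2 := tendsto_pi_nhds.1 (tendsto_qCoeff hν) 2
  -- A zero denominator would make the quotient in `besselCoeff_upper_eq` zero by convention,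
  -- whereas its closed form is positive.
  have hne : (1 + 2 / ν) ^ 2 * besselCoeff ν 1 ^ 2 - 2 * (1 + 2 * (2 / ν)) * besselCoeff ν 2 ≠ 0 := by
    intro h0
    have h3 := besselCoeff_upper_eq hν
    rw [h0, div_zero, mul_zero] at h3
    have : 0 < 4 * ν * (ν + 1) * (ν + 2) ^ 2 / (ν ^ 2 + 8 * ν + 8) := by positivity
    linarith
  have h3 := (((h1.const_mul (1 + 2 / ν)).div (((h1.pow 2).const_mul ((1 + 2 / ν) ^ 2)).sub
    (h2.const_mul (2 * (1 + 2 * (2 / ν))))) hne)).const_mul 4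
  rw [besselCoeff_upper_eq hν] at h3
  refine h3.congr' ?_
  filter_upwards [eventually_mem_Ioo] with q hq
  have : 0 < 1 - q := by linarith [hq.2]
  rw [upperBound_eq hν hq.1 hq.2]
  simp only [Pi.div_apply]
  field_simp

end

/-! ### The analytic root and its radius of starlikeness -/

/-- On a disk `g'/g` has a primitive `L`, and the segment integral is `L(z) - L(0)`. Then `g ·
exp(-(L - L(0)))` has zero derivative and equals `1` at the centre. -/
theorem segLog_spec {g : ℂ → ℂ} {ρ : ℝ} (hg : DifferentiableOn ℂ g (Metric.ball 0 ρ))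
    (hne : ∀ z ∈ Metric.ball (0 : ℂ) ρ, g z ≠ 0) (hg0 : g 0 = 1) {z : ℂ}
    (hz : z ∈ Metric.ball (0 : ℂ) ρ) :
    HasDerivAt (segLog g) (deriv g z / g z) z ∧ Complex.exp (segLog g z) = g z := by
  have hopen : IsOpen (Metric.ball (0 : ℂ) ρ) := Metric.isOpen_ball
  have hdiff : DifferentiableOn ℂ (fun z => deriv g z / g z) (Metric.ball 0 ρ) :=
    (hg.deriv hopen).div hg hne
  obtain ⟨L, hL⟩ := hdiff.isExactOn_ball
  have h0 : (0 : ℂ) ∈ Metric.ball (0 : ℂ) ρ :=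
    Metric.mem_ball_self ((norm_nonneg z).trans_lt (mem_ball_zero_iff.1 hz))
  have hseg : ∀ w ∈ Metric.ball (0 : ℂ) ρ, segLog g w = L w - L 0 := by
    intro w hw
    have hmem : ∀ t ∈ Set.uIcc (0 : ℝ) 1, (t : ℂ) * w ∈ Metric.ball (0 : ℂ) ρ := by
      intro t ht
      rw [Set.uIcc_of_le zero_le_one] at ht
      rw [mem_ball_zero_iff, norm_mul, Complex.norm_real, Real.norm_of_nonneg ht.1]
      exact (mul_le_of_le_one_left (norm_nonneg _) ht.2).trans_lt (mem_ball_zero_iff.1 hw)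
    have hlin : ∀ t : ℝ, HasDerivAt (fun t : ℝ => (t : ℂ) * w) w t := fun t => by
      simpa using (Complex.ofRealCLM.hasDerivAt (x := t)).mul_const w
    have hFTC := intervalIntegral.integral_eq_sub_of_hasDerivAt
      (f := fun t : ℝ => L ((t : ℂ) * w))
      (f' := fun t : ℝ => w * (deriv g ((t : ℂ) * w) / g ((t : ℂ) * w))) (a := 0) (b := 1) ?_ ?_
    · rw [segLog, hFTC]; simp
    · intro t ht
      have h1 := (hL _ (hmem t ht)).scomp t (hlin t)
      exact h1
    · refine ContinuousOn.intervalIntegrable (continuousOn_const.mul ?_)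
      exact hdiff.continuousOn.comp (f := fun t : ℝ => (t : ℂ) * w)
        (fun t _ => (hlin t).continuousAt.continuousWithinAt) hmem
  have hev : segLog g =ᶠ[𝓝 z] fun w => L w - L 0 :=
    Filter.eventuallyEq_of_mem (hopen.mem_nhds hz) hseg
  refine ⟨((hL z hz).sub_const _).congr_of_eventuallyEq hev, ?_⟩
  have hder : ∀ w ∈ Metric.ball (0 : ℂ) ρ,
      HasDerivAt (fun w => Complex.exp (-(L w - L 0)) * g w) 0 w := by
    intro w hw
    have h1 := (((hL w hw).sub_const (L 0)).neg.cexp).mul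
      (hg.differentiableAt (hopen.mem_nhds hw)).hasDerivAt
    refine h1.congr_deriv ?_
    have := hne w hw
    field_simp
    ring
  have hconst := hopen.is_const_of_deriv_eq_zero (convex_ball _ _).isPreconnected
    (fun w hw => (hder w hw).differentiableAt.differentiableWithinAt)
    (fun w hw => (hder w hw).deriv) hz h0
  simp only [sub_self, neg_zero, Complex.exp_zero, hg0, mul_one] at hconst
  rw [hseg z hz]
  rw [Complex.exp_neg, inv_mul_eq_one₀ (Complex.exp_ne_zero _)] at hconst
  exact hconst

/-- The function `z exp(log g(z) / ν)` for the branch of `log g` given by `segLog`. -/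
noncomputable def segRoot (ν : ℝ) (g : ℂ → ℂ) (z : ℂ) : ℂ :=
  z * Complex.exp (segLog g z / (ν : ℂ))

section
variable {ν c v w : ℝ} {a : ℕ → ℝ}

theorem hasDerivAt_altSeries_sq (ha : ExpBounded a) (z : ℂ) :
    HasDerivAt (fun z : ℂ => altSeries a ((z / c) ^ 2))
      (altSeries (derivCoeff a) ((z / c) ^ 2) * (2 * (z / c) * (1 / c))) z := by
  have h1 := (((hasDerivAt_id z).div_const (c : ℂ)).pow 2)
  have h2 := (ha.hasDerivAt ((z / c) ^ 2)).comp z h1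
  refine h2.congr_deriv ?_
  simp

theorem norm_div_sq_lt (hc : 0 < c) {z : ℂ}
    (hz : z ∈ Metric.ball (0 : ℂ) (c * √w)) : ‖(z / (c : ℂ)) ^ 2‖ < w := by
  rw [mem_ball_zero_iff] at hz
  rw [norm_pow, norm_div, Complex.norm_real, Real.norm_of_nonneg hc.le]
  rw [← Real.lt_sqrt (by positivity), div_lt_iff₀ hc]
  linarith

/-- The analytic root of an even series with positive values on `[0, w)` in the squared variable:
analyticity, logarithmic derivative, and positivity on the positive half-axis. -/
theorem segRoot_spec (ha : a ∈ closure rootedCoeffs) (h0 : a 0 = 1) (hν : 0 < ν) (hc : 0 < c)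
    (hF : ∀ t ∈ Set.Ico 0 w, 0 < altSeriesReal a t) :
    (∀ z ∈ Metric.ball (0 : ℂ) (c * √w),
      HasDerivAt (segRoot ν fun z => altSeries a ((z / c) ^ 2))
        (Complex.exp (segLog (fun z => altSeries a ((z / c) ^ 2)) z / ν) *
          (1 + (2 / ν : ℝ) * (z / c) ^ 2 * (altSeries (derivCoeff a) ((z / c) ^ 2) /
            altSeries a ((z / c) ^ 2)))) z) ∧
    ∀ x : ℝ, 0 < x → x < c * √w →
      segRoot ν (fun z => altSeries a ((z / c) ^ 2)) x =
        (((x ^ ν * altSeriesReal a ((x / c) ^ 2)) ^ (1 / ν) : ℝ) : ℂ) := by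
  have hab := besselBounded_of_mem_closure ha
  set g : ℂ → ℂ := fun z => altSeries a ((z / c) ^ 2) with hg
  have hder := hasDerivAt_altSeries_sq (c := c) hab.expBounded
  have hgd : Differentiable ℂ g := fun z => (hder z).differentiableAt
  -- The minimum modulus on a circle is attained on the positive axis, where `F` is positive below
  -- `w`.
  have hne : ∀ z ∈ Metric.ball (0 : ℂ) (c * √w), g z ≠ 0 := by
    intro z hz h
    have hlt := norm_div_sq_lt hc hz
    have h1 := (closure_rootedCoeffs_inequalities ha (norm_nonneg ((z / (c : ℂ)) ^ 2))
      fun t ht => hF t ⟨ht.1, ht.2.trans_lt hlt⟩).1 _ le_rfl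
    have h2 := hF _ ⟨norm_nonneg _, hlt⟩
    have h3 : altSeries a ((z / c) ^ 2) = 0 := h
    rw [h3, norm_zero] at h1
    linarith
  have hcz : (c : ℂ) ≠ 0 := by exact_mod_cast hc.ne'
  have hνz : (ν : ℂ) ≠ 0 := by exact_mod_cast hν.ne'
  have hg0 : g 0 = 1 := by
    have h1 := ofReal_altSeriesReal a 0
    rw [altSeriesReal_zero, h0] at h1
    simpa [hg] using h1.symm
  have hspec := fun z hz => segLog_spec hgd.differentiableOn hne hg0 (z := z) hz
  constructor
  · intro z hz
    have h1 := (hasDerivAt_id z).mul (((hspec z hz).1.div_const (ν : ℂ)).cexp)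
    refine h1.congr_deriv ?_
    have h2 : altSeries a ((z / c) ^ 2) ≠ 0 := hne z hz
    rw [(hder z).deriv]
    simp only [id, hg]
    push_cast
    field_simp
  · intro x hx hxw
    have hxb : (x : ℂ) ∈ Metric.ball (0 : ℂ) (c * √w) := by
      rw [mem_ball_zero_iff, Complex.norm_real, Real.norm_of_nonneg hx.le]; exact hxw
    have hreal : ∀ (b : ℕ → ℝ) (y : ℝ), altSeries b (((y : ℂ) / c) ^ 2) =
        ((altSeriesReal b ((y / c) ^ 2) : ℝ) : ℂ) := fun b y => by
      rw [ofReal_altSeriesReal]; push_cast; rfl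
    -- For real `x` the integrand is real along the segment, so the logarithm is real and the branch
    -- is the positive root.
    obtain ⟨s, hs⟩ : ∃ s : ℝ, segLog g x = s := by
      refine ⟨∫ t in (0 : ℝ)..1, x * (altSeriesReal (derivCoeff a) ((t * x / c) ^ 2) *
        (2 * (t * x / c) * (1 / c)) / altSeriesReal a ((t * x / c) ^ 2)), ?_⟩
      rw [segLog, ← intervalIntegral.integral_ofReal]
      refine intervalIntegral.integral_congr fun t _ => ?_
      have e1 : ((t : ℂ) * x) = ((t * x : ℝ) : ℂ) := by push_cast; rfl
      simp only [e1, (hder _).deriv, hg, hreal]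
      push_cast
      rfl
    have hexp := (hspec x hxb).2
    have hgx : g x = ((altSeriesReal a ((x / c) ^ 2) : ℝ) : ℂ) := hreal a x
    rw [hs, hgx, ← Complex.ofReal_exp, Complex.ofReal_inj] at hexp
    rw [segRoot, hs, ← hexp, Real.mul_rpow (by positivity) (by positivity), ← Real.rpow_mul hx.le,
      mul_one_div_cancel hν.ne', Real.rpow_one, ← Real.exp_mul, mul_one_div]
    push_cast
    rfl

/-- At `z = c√v` the quotient `z f'/f` is exactly `0`, so no larger disk qualifies. Inside, `|ε V
F'(V)/F(V)|` is at most its value `-ε|V| F'(|V|)/F(|V|)` on the axis, which is below `1` before the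
first zero of `F + ε t F'`. Disks being open, the radius itself is admissible. -/
theorem starlikeRadius_segRoot (ha : a ∈ closure rootedCoeffs) (h0 : a 0 = 1) (hν : 0 < ν)
    (hc : 0 < c) (hv : 0 < v) (hvw : v < w) (hF : ∀ t ∈ Set.Ico 0 w, 0 < altSeriesReal a t)
    (hH : ∀ t ∈ Set.Ico 0 v, 0 < eulerSeries a (2 / ν) t) (hHv : eulerSeries a (2 / ν) v = 0) :
    starlikeRadius (segRoot ν fun z => altSeries a ((z / c) ^ 2)) = c * √v := by
  set f := segRoot ν fun z => altSeries a ((z / c) ^ 2) with hf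
  have hder := (segRoot_spec ha h0 hν hc hF).1
  have hR : 0 < c * √v := by positivity
  have hRw : c * √v < c * √w := mul_lt_mul_of_pos_left (Real.sqrt_lt_sqrt hv.le hvw) hc
  have hsub : Metric.ball (0 : ℂ) (c * √v) ⊆ Metric.ball 0 (c * √w) := Metric.ball_subset_ball hRw.le
  have hquot : ∀ z ∈ Metric.ball (0 : ℂ) (c * √w), z ≠ 0 → z * deriv f z / f z =
      1 + (2 / ν : ℝ) * (z / c) ^ 2 * (altSeries (derivCoeff a) ((z / c) ^ 2) /
            altSeries a ((z / c) ^ 2)) := by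
    intro z hz hz0
    rw [(hder z hz).deriv, hf, segRoot, ← mul_assoc, mul_div_cancel_left₀]
    exact mul_ne_zero hz0 (Complex.exp_ne_zero _)
  have hset : {r : ℝ | 0 < r ∧ DifferentiableOn ℂ f (Metric.ball 0 r) ∧
      ∀ z ∈ Metric.ball (0 : ℂ) r, z ≠ 0 → 0 < (z * deriv f z / f z).re} = Set.Ioc 0 (c * √v) := by
    ext r
    constructor
    · rintro ⟨hr, -, hre⟩
      refine ⟨hr, ?_⟩
      by_contra! hlt
      have hmem : ((c * √v : ℝ) : ℂ) ∈ Metric.ball (0 : ℂ) r := by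
        rw [mem_ball_zero_iff, Complex.norm_real, Real.norm_of_nonneg hR.le]; exact hlt
      have hmem' : ((c * √v : ℝ) : ℂ) ∈ Metric.ball (0 : ℂ) (c * √w) := by
        rw [mem_ball_zero_iff, Complex.norm_real, Real.norm_of_nonneg hR.le]; exact hRw
      have hne : ((c * √v : ℝ) : ℂ) ≠ 0 := by exact_mod_cast hR.ne'
      have h1 := hre _ hmem hne
      rw [hquot _ hmem' hne] at h1
      have e1 : (((c * √v : ℝ) : ℂ) / c) ^ 2 = (v : ℂ) := by
        rw [← Complex.ofReal_div, mul_div_cancel_left₀ _ hc.ne', ← Complex.ofReal_pow,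
          Real.sq_sqrt hv.le]
      rw [e1, ← ofReal_altSeriesReal, ← ofReal_altSeriesReal, ← Complex.ofReal_div,
        ← Complex.ofReal_mul, ← Complex.ofReal_mul, ← Complex.ofReal_one, ← Complex.ofReal_add,
        Complex.ofReal_re] at h1
      have hFv := hF v ⟨hv.le, hvw⟩
      rw [eulerSeries] at hHv
      have h2 : 1 + 2 / ν * v * (altSeriesReal (derivCoeff a) v / altSeriesReal a v) =
          (altSeriesReal a v + 2 / ν * v * altSeriesReal (derivCoeff a) v) / altSeriesReal a v := by
        field_simp
      rw [h2, hHv, zero_div] at h1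
      exact lt_irrefl _ h1
    · rintro ⟨hr, hrle⟩
      have hsubr : Metric.ball (0 : ℂ) r ⊆ Metric.ball 0 (c * √v) := Metric.ball_subset_ball hrle
      refine ⟨hr, fun z hz => (hder z (hsub (hsubr hz))).differentiableAt.differentiableWithinAt,
        fun z hz hz0 => ?_⟩
      rw [hquot z (hsub (hsubr hz)) hz0]
      have hlt := norm_div_sq_lt hc (hsubr hz)
      set V := (z / (c : ℂ)) ^ 2
      have hFp : ∀ t ∈ Set.Icc 0 ‖V‖, 0 < altSeriesReal a t :=
        fun t ht => hF t ⟨ht.1, (ht.2.trans_lt hlt).trans hvw⟩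
      obtain ⟨i1, i2, -⟩ := closure_rootedCoeffs_inequalities ha (norm_nonneg V) hFp
      have hFV := hFp ‖V‖ ⟨norm_nonneg _, le_rfl⟩
      have j1 := i1 V le_rfl
      have j2 := i2 V le_rfl
      have hE := hH ‖V‖ ⟨norm_nonneg _, hlt⟩
      rw [eulerSeries] at hE
      have hn : ‖((2 / ν : ℝ) : ℂ) * V * (altSeries (derivCoeff a) V / altSeries a V)‖ < 1 := by
        rw [norm_mul, norm_mul, norm_div, Complex.norm_real, Real.norm_of_nonneg (by positivity),
          ← mul_div_assoc, div_lt_one (hFV.trans_le j1)]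
        refine lt_of_mul_lt_mul_right ?_ hFV.le
        calc 2 / ν * ‖V‖ * ‖altSeries (derivCoeff a) V‖ * altSeriesReal a ‖V‖
            = 2 / ν * ‖V‖ * (‖altSeries (derivCoeff a) V‖ * altSeriesReal a ‖V‖) := by ring
          _ ≤ 2 / ν * ‖V‖ * (‖altSeries a V‖ * -altSeriesReal (derivCoeff a) ‖V‖) := by gcongr
          _ = ‖altSeries a V‖ * (-(2 / ν * ‖V‖ * altSeriesReal (derivCoeff a) ‖V‖)) := by ring
          _ < ‖altSeries a V‖ * altSeriesReal a ‖V‖ :=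
            mul_lt_mul_of_pos_left (by linarith) (hFV.trans_le j1)
      have h3 := Complex.abs_re_le_norm
        (((2 / ν : ℝ) : ℂ) * V * (altSeries (derivCoeff a) V / altSeries a V))
      rw [Complex.add_re, Complex.one_re]
      linarith [(abs_le.1 h3).1]
  rw [starlikeRadius, hset, csSup_Ioc hR]

theorem isLeast_mul_sqrt (hc : 0 < c) {ε : ℝ} {p : ℝ → Prop}
    (hp : ∀ r, 0 < r → (p r ↔ eulerSeries a ε ((r / c) ^ 2) = 0))
    (hv : IsLeast {t | 0 < t ∧ eulerSeries a ε t = 0} v) :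
    IsLeast {r | 0 < r ∧ p r} (c * √v) := by
  have hv0 := hv.1.1
  have hR : 0 < c * √v := by positivity
  refine ⟨⟨hR, ?_⟩, fun r hr => ?_⟩
  · rw [hp _ hR, mul_div_cancel_left₀ _ hc.ne', Real.sq_sqrt hv0.le]
    exact hv.1.2
  · have h1 := hv.2 ⟨by have := hr.1; positivity, (hp r hr.1).1 hr.2⟩
    have h2 : 0 ≤ r / c := by have := hr.1; positivity
    have h3 := (Real.sqrt_le_left h2).2 h1
    rw [le_div_iff₀ hc] at h3
    linarith

/-- The derivative of `K (x/2)^ν F((x/c)²)`. -/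
theorem hasDerivAt_rpow_mul_altSeriesReal (ha : ExpBounded a) (hν : 0 < ν) (K : ℝ) {x : ℝ}
    (hx : 0 < x) :
    HasDerivAt (fun x : ℝ => K * ((x / 2) ^ ν * altSeriesReal a ((x / c) ^ 2)))
      (K * (ν / x * (x / 2) ^ ν * eulerSeries a (2 / ν) ((x / c) ^ 2))) x := by
  have h1 := ((hasDerivAt_id x).div_const 2).rpow_const (p := ν) (Or.inl (by simpa using hx.ne'))
  have h2 := (ha.hasDerivAt_real ((x / c) ^ 2)).comp x (((hasDerivAt_id x).div_const c).pow 2)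
  refine ((h1.mul h2).const_mul K).congr_deriv ?_
  have h3 : (x / 2) ^ (ν - 1) = (x / 2) ^ ν / (x / 2) := Real.rpow_sub_one (by positivity) ν
  simp only [id, h3, eulerSeries, Function.comp, Pi.pow_apply]
  field_simp
  push_cast
  ring

end

/-! ### Translation to the Jackson and classical Bessel functions -/

theorem qPochInf_ne_zero {b q : ℝ} (hb : 0 < b) (hb' : b < 1) (hq : 0 < q) (hq' : q < 1) :
    qPochInf b q ≠ 0 := by
  have h := tprod_one_add_ne_zero_of_summable (f := fun k : ℕ => -(b * q ^ k)) (fun k => ?_) ?_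
  · simpa only [qPochInf, sub_eq_add_neg] using h
  · have : q ^ k ≤ 1 := pow_le_one₀ hq.le hq'.le
    have : b * q ^ k < 1 := by nlinarith
    linarith
  · simp only [norm_neg, norm_mul, norm_pow]
    exact (summable_geometric_of_lt_one (norm_nonneg _)
      (by rwa [Real.norm_of_nonneg hq.le])).mul_left _

section
variable {ν q : ℝ}

theorem cConst_ne_zero (hν : 0 < ν) (hq : 0 < q) (hq' : q < 1) : cConst ν q ≠ 0 :=
  div_ne_zero (qPochInf_ne_zero hq hq' hq hq')
    (qPochInf_ne_zero (Real.rpow_pos_of_pos hq _)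
      (Real.rpow_lt_one hq.le hq' (by linarith)) hq hq')

/-- Rescaling by `1 - q` moves the factor `(1-q)^{2n}` into the coefficients, where it is needed for
a finite limit as `q ↗ 1`. -/
theorem jacksonEntire_eq (hq' : q < 1) :
    jacksonEntire ν q = fun z => altSeries (qCoeff ν q) ((z / (2 * (1 - q) : ℝ)) ^ 2) := by
  funext z
  refine tsum_congr fun n => ?_
  have h1 : ((1 - q : ℝ) : ℂ) ≠ 0 := by exact_mod_cast (by linarith : 0 < 1 - q).ne'
  have h2 : ((z / (2 * (1 - q) : ℝ)) ^ 2) ^ n = (z / 2) ^ (2 * n) / ((1 - q : ℝ) : ℂ) ^ (2 * n) := by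
    rw [← pow_mul, Complex.ofReal_mul, Complex.ofReal_ofNat, ← div_div, div_pow (z / 2)]
  rw [h2, qCoeff, Complex.ofReal_div, Complex.ofReal_mul ((1 - q) ^ (2 * n)), Complex.ofReal_pow]
  field_simp

theorem fJackson_eq (hq' : q < 1) : fJackson ν q =
    segRoot ν fun z => altSeries (qCoeff ν q) ((z / (2 * (1 - q) : ℝ)) ^ 2) := by
  funext z
  rw [fJackson, segRoot, jacksonEntire_eq hq']

theorem jacksonJ_eq (hq' : q < 1) {x : ℝ} (hx : 0 < x) : jacksonJ ν q x =
    (((cConst ν q)⁻¹ * ((x / 2) ^ ν *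
      altSeriesReal (qCoeff ν q) ((x / (2 * (1 - q))) ^ 2)) : ℝ) : ℂ) := by
  have h1 : (1 - q) ≠ 0 := (by linarith : 0 < 1 - q).ne'
  rw [jacksonJ, cConst, inv_div, Complex.ofReal_mul, altSeriesReal,
    ← tsum_mul_left (a := (x / 2) ^ ν), Complex.ofReal_tsum]
  congr 1
  refine tsum_congr fun n => ?_
  have e1 : ((x : ℂ) / 2) ^ (2 * (n : ℂ) + (ν : ℂ)) = (((x / 2) ^ (2 * n) * (x / 2) ^ ν : ℝ) : ℂ) := by
    rw [← Real.rpow_natCast, ← Real.rpow_add (by positivity), Complex.ofReal_cpow (by positivity)]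
    push_cast
    rfl
  rw [e1]
  have e2 : (x / 2) ^ ν * ((-1) ^ n * qCoeff ν q n * ((x / (2 * (1 - q))) ^ 2) ^ n) =
      (-1) ^ n * ((x / 2) ^ (2 * n) * (x / 2) ^ ν) / (qPoch q q n * qPoch (q ^ (ν + 1)) q n) *
        q ^ ((n : ℝ) * ((n : ℝ) + ν)) := by
    rw [qCoeff, ← pow_mul, ← div_div x, div_pow (x / 2)]
    field_simp
  rw [e2]
  push_cast
  rfl

theorem mul_deriv_jacksonJ_eq_zero_iff (hν : 0 < ν) (hq : 0 < q) (hq' : q < 1) {r : ℝ}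
    (hr : 0 < r) : (r : ℂ) * deriv (fun x : ℝ => jacksonJ ν q (x : ℂ)) r = 0 ↔
      eulerSeries (qCoeff ν q) (2 / ν) ((r / (2 * (1 - q))) ^ 2) = 0 := by
  have h1 := (hasDerivAt_rpow_mul_altSeriesReal (c := 2 * (1 - q))
    (qCoeff_besselBounded hν hq hq').expBounded hν (cConst ν q)⁻¹ hr).ofReal_comp
  have h2 : (fun x : ℝ => jacksonJ ν q (x : ℂ)) =ᶠ[𝓝 r] fun x : ℝ =>
      (((cConst ν q)⁻¹ * ((x / 2) ^ ν *
        altSeriesReal (qCoeff ν q) ((x / (2 * (1 - q))) ^ 2)) : ℝ) : ℂ) := by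
    filter_upwards [lt_mem_nhds hr] with x hx
    exact jacksonJ_eq hq' hx
  rw [(h1.congr_of_eventuallyEq h2).deriv, ← Complex.ofReal_mul, Complex.ofReal_eq_zero]
  have h3 := inv_ne_zero (cConst_ne_zero hν hq hq')
  have h4 : ν / r * (r / 2) ^ ν ≠ 0 := by positivity
  simp [mul_eq_zero, h3, h4, hr.ne']

end

theorem besselJ_eq {ν x : ℝ} (hν : 0 < ν) (hx : 0 < x) : besselJ ν x =
    (Real.Gamma (ν + 1))⁻¹ * ((x / 2) ^ ν * altSeriesReal (besselCoeff ν) ((x / 2) ^ 2)) := by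
  have hG : ∀ n : ℕ, Real.Gamma ((n : ℝ) + ν + 1) =
      Real.Gamma (ν + 1) * ∏ k ∈ Finset.range n, (ν + 1 + k) := by
    intro n
    induction n with
    | zero => simp
    | succ n ih =>
      have e : ((n + 1 : ℕ) : ℝ) + ν + 1 = ((n : ℝ) + ν + 1) + 1 := by push_cast; ring
      rw [e, Real.Gamma_add_one (by positivity), ih, Finset.prod_range_succ]
      ring
  rw [besselJ, altSeriesReal, ← tsum_mul_left, ← tsum_mul_left]
  refine tsum_congr fun n => ?_
  have h1 : Real.Gamma (ν + 1) ≠ 0 := (Real.Gamma_pos_of_pos (by linarith)).ne'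
  have h2 : ∏ k ∈ Finset.range n, (ν + 1 + (k : ℝ)) ≠ 0 :=
    Finset.prod_ne_zero_iff.2 fun k _ => by positivity
  have e1 : (x / 2) ^ (2 * (n : ℝ) + ν) = ((x / 2) ^ 2) ^ n * (x / 2) ^ ν := by
    rw [Real.rpow_add (by positivity), ← pow_mul, ← Real.rpow_natCast]
    push_cast
    rfl
  rw [hG, e1, besselCoeff]
  field_simp

theorem deriv_besselJ_eq_zero_iff {ν r : ℝ} (hν : 0 < ν) (hr : 0 < r) :
    deriv (besselJ ν) r = 0 ↔ eulerSeries (besselCoeff ν) (2 / ν) ((r / 2) ^ 2) = 0 := by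
  have h1 := hasDerivAt_rpow_mul_altSeriesReal (c := 2)
    (besselBounded_of_mem_closure (besselCoeff_mem_closure hν)).expBounded hν
    (Real.Gamma (ν + 1))⁻¹ hr
  have h2 : besselJ ν =ᶠ[𝓝 r] fun x : ℝ => (Real.Gamma (ν + 1))⁻¹ *
      ((x / 2) ^ ν * altSeriesReal (besselCoeff ν) ((x / 2) ^ 2)) := by
    filter_upwards [lt_mem_nhds hr] with x hx
    exact besselJ_eq hν hx
  rw [(h1.congr_of_eventuallyEq h2).deriv]
  have h3 := inv_ne_zero (Real.Gamma_pos_of_pos (by linarith : 0 < ν + 1)).ne'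
  have h4 : ν / r * (r / 2) ^ ν ≠ 0 := by positivity
  simp [mul_eq_zero, h3, h4]

/-! ### Proof of the theorem -/

/-- The radius of starlikeness in terms of the least zero of `F + (2/ν) t F'`. -/
theorem exists_starlikeRadius_fJackson_eq {ν q : ℝ} (hν : 0 < ν) (hq : 0 < q) (hq' : q < 1) :
    ∃ v w, v < w ∧ (∀ t ∈ Set.Ico 0 w, 0 < altSeriesReal (qCoeff ν q) t) ∧
      IsLeast {t | 0 < t ∧ eulerSeries (qCoeff ν q) (2 / ν) t = 0} v ∧
      starlikeRadius (fJackson ν q) = 2 * (1 - q) * √v ∧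
      lowerBound ν q < (2 * (1 - q) * √v) ^ 2 ∧ (2 * (1 - q) * √v) ^ 2 < upperBound ν q := by
  have hq1 : 0 < 1 - q := by linarith
  have hcl := qCoeff_mem_closure hν hq hq'
  obtain ⟨v, hv, -, hH, ⟨w, hvw, hF, -⟩, hlow, hup⟩ := exists_isLeast_eulerSeries hcl
    (qCoeff_zero ν q) (qCoeff_pos hν hq hq' 1) (qCoeff_pos hν hq hq' 2)
    (two_mul_qCoeff_two_lt hν hq hq') (show 0 < 2 / ν by positivity)
  have hsq : (2 * (1 - q) * √v) ^ 2 = 4 * (1 - q) ^ 2 * v := by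
    rw [mul_pow, Real.sq_sqrt hv.1.1.le]; ring
  have h4 : 0 < 4 * (1 - q) ^ 2 := by positivity
  refine ⟨v, w, hvw, hF, hv, ?_, ?_, ?_⟩
  · rw [fJackson_eq hq']
    exact starlikeRadius_segRoot hcl (qCoeff_zero ν q) hν (by positivity) hv.1.1 hvw hF hH hv.1.2
  · rw [hsq, lowerBound_eq hν hq hq']
    exact mul_lt_mul_of_pos_left hlow h4
  · rw [hsq, upperBound_eq hν hq hq']
    exact mul_lt_mul_of_pos_left hup h4

theorem theorem1 (ν : ℝ) (hν : 0 < ν) :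
    (∀ q : ℝ, 0 < q → q < 1 →
      -- `f` is analytic and normalized in the disk of radius `r*(f)`, and there it is the
      -- branch of the root that is positive on the positive half-axis
      (DifferentiableOn ℂ (fJackson ν q) (Metric.ball 0 (starlikeRadius (fJackson ν q))) ∧
        fJackson ν q 0 = 0 ∧ deriv (fJackson ν q) 0 = 1 ∧
        ∀ x : ℝ, 0 < x → x < starlikeRadius (fJackson ν q) →
          ∃ y : ℝ, 0 < y ∧ 2 ^ (ν : ℂ) * (cConst ν q : ℂ) * jacksonJ ν q (x : ℂ) = (y : ℂ) ∧
            fJackson ν q (x : ℂ) = ((y ^ (1 / ν) : ℝ) : ℂ)) ∧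
      -- the radius of starlikeness is the smallest positive root of `r * dJ(r; q)/dr = 0`
      IsLeast {r : ℝ | 0 < r ∧ (r : ℂ) * deriv (fun x : ℝ => jacksonJ ν q (x : ℂ)) r = 0}
        (starlikeRadius (fJackson ν q)) ∧
      lowerBound ν q < starlikeRadius (fJackson ν q) ^ 2 ∧
      starlikeRadius (fJackson ν q) ^ 2 < upperBound ν q) ∧
    -- the limit `q ↗ 1`: the bounds for the first positive zero `j` of `J_ν'`
    (∃ j : ℝ, IsLeast {x : ℝ | 0 < x ∧ deriv (besselJ ν) x = 0} j ∧
      Tendsto (fun q : ℝ => starlikeRadius (fJackson ν q) / (1 - q)) (𝓝[<] 1) (𝓝 j) ∧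
      Tendsto (fun q : ℝ => lowerBound ν q / (1 - q) ^ 2) (𝓝[<] 1)
        (𝓝 (4 * ν * (ν + 1) / (ν + 2))) ∧
      Tendsto (fun q : ℝ => upperBound ν q / (1 - q) ^ 2) (𝓝[<] 1)
        (𝓝 (4 * ν * (ν + 1) * (ν + 2) ^ 2 / (ν ^ 2 + 8 * ν + 8))) ∧
      4 * ν * (ν + 1) / (ν + 2) < j ^ 2 ∧
      j ^ 2 < 4 * ν * (ν + 1) * (ν + 2) ^ 2 / (ν ^ 2 + 8 * ν + 8)) := by
  constructor
  · intro q hq hq'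
    have hq1 : 0 < 1 - q := by linarith
    have hc : 0 < 2 * (1 - q) := by positivity
    obtain ⟨v, w, hvw, hF, hv, hR, hlow, hup⟩ := exists_starlikeRadius_fJackson_eq hν hq hq'
    have hv0 : 0 < v := hv.1.1
    have hRw : 2 * (1 - q) * √v < 2 * (1 - q) * √w :=
      mul_lt_mul_of_pos_left (Real.sqrt_lt_sqrt hv0.le hvw) hc
    obtain ⟨hder, hreal⟩ := segRoot_spec (qCoeff_mem_closure hν hq hq') (qCoeff_zero ν q) hν hc hF
    rw [← fJackson_eq hq'] at hder hreal
    rw [hR]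
    refine ⟨⟨fun z hz => ?_, ?_, ?_, fun x hx hxR => ?_⟩,
      isLeast_mul_sqrt hc (fun r hr => mul_deriv_jacksonJ_eq_zero_iff hν hq hq' hr) hv, hlow, hup⟩
    · exact (hder z (Metric.ball_subset_ball hRw.le hz)).differentiableAt.differentiableWithinAt
    · simp [fJackson]
    · rw [(hder 0 (Metric.mem_ball_self (lt_of_le_of_lt (by positivity) hRw))).deriv]
      simp [segLog]
    · have hxw : x < 2 * (1 - q) * √w := hxR.trans hRw
      have hlt : (x / (2 * (1 - q))) ^ 2 < w := by
        rw [← Real.lt_sqrt (by positivity), div_lt_iff₀ hc]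
        linarith
      refine ⟨x ^ ν * altSeriesReal (qCoeff ν q) ((x / (2 * (1 - q))) ^ 2),
        mul_pos (Real.rpow_pos_of_pos hx _) (hF _ ⟨by positivity, hlt⟩), ?_, hreal x hx hxw⟩
      have h2 : ((2 : ℂ) ^ (ν : ℂ)) = ((2 ^ ν : ℝ) : ℂ) := by
        rw [Complex.ofReal_cpow (by norm_num)]; simp
      have hcne := cConst_ne_zero hν hq hq'
      rw [jacksonJ_eq hq' hx, h2, ← Complex.ofReal_mul, ← Complex.ofReal_mul,
        Real.div_rpow hx.le (by norm_num)]
      congr 1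
      have : (2 : ℝ) ^ ν ≠ 0 := by positivity
      field_simp
  · have hcl := besselCoeff_mem_closure hν
    have hε : 0 < 2 / ν := by positivity
    obtain ⟨v, hv, -, hH, ⟨w, hvw, -, hneg⟩, hlow, hup⟩ := exists_isLeast_eulerSeries hcl
      (besselCoeff_zero ν) (by rw [besselCoeff_one]; positivity)
      (by rw [besselCoeff_two]; positivity) (two_mul_besselCoeff_two_lt hν) hε
    have hv0 : 0 < v := hv.1.1
    have hsq : (2 * √v) ^ 2 = 4 * v := by rw [mul_pow, Real.sq_sqrt hv0.le]; ring
    refine ⟨2 * √v, isLeast_mul_sqrt two_pos (fun r hr => deriv_besselJ_eq_zero_iff hν hr) hv, ?_,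
      tendsto_lowerBound hν, tendsto_upperBound hν, ?_, ?_⟩
    · have hlim : Tendsto (fun q : ℝ => (starlikeRadius (fJackson ν q) / (2 * (1 - q))) ^ 2)
          (𝓝[<] 1) (𝓝 v) := by
        refine tendsto_isLeast_eulerSeries
          (eventually_mem_Ioo.mono fun q hq => qCoeff_besselBounded hν hq.1 hq.2)
          (Eventually.of_forall fun q => qCoeff_zero ν q) (besselBounded_of_mem_closure hcl)
          (tendsto_qCoeff hν) hε.le hv0 (eventually_mem_Ioo.mono fun q hq => ?_) hH hvw hneg
        obtain ⟨u, -, -, -, hu, hR, -⟩ := exists_starlikeRadius_fJackson_eq hν hq.1 hq.2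
        have hq1 : 0 < 1 - q := by linarith [hq.2]
        rw [hR, mul_div_cancel_left₀ _ (by positivity), Real.sq_sqrt hu.1.1.le]
        exact hu
      refine (hlim.sqrt.const_mul 2).congr' ?_
      filter_upwards [eventually_mem_Ioo] with q hq
      obtain ⟨u, -, -, -, hu, hR, -⟩ := exists_starlikeRadius_fJackson_eq hν hq.1 hq.2
      have hq1 : 0 < 1 - q := by linarith [hq.2]
      rw [hR, mul_div_cancel_left₀ _ (by positivity), Real.sqrt_sq (Real.sqrt_nonneg _)]
      field_simp
    · rw [hsq]
      have e : 4 * ν * (ν + 1) / (ν + 2) = 4 * (1 / ((1 + 2 / ν) * besselCoeff ν 1)) := by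
        rw [besselCoeff_one]; field_simp
      rw [e]
      exact mul_lt_mul_of_pos_left hlow (by norm_num)
    · rw [hsq, ← besselCoeff_upper_eq hν]
      exact mul_lt_mul_of_pos_left hup (by norm_num)
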